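/- Let $n\ge 1$, let $\Omega\subset\mathbb R^n$ be a bounded domain (nonempty, open, connected), let $F:\Omega\to\mathbb R$ be continuous and bounded, and let $g:\partial\Omega\to\mathbb R$ be continuous (hence bounded). For $\phi\in C^2(\Omega)$ put $$\Delta_\infty\phi=\sum_{i,j=1}^n\frac{\partial \phi}{\partial x_i}\frac{\partial \phi}{\partial x_j}\frac{\partial^2\phi}{\partial x_i\partial x_j}.$$ A lower semicontinuous $v:\Omega\to(-\infty,\infty]$ is a viscosity supersolution of $\Delta_\infty v=F$ in $\Omega$ if $\Delta_\infty\phi(x_0)\le F(x_0)$ whenever $x_0\in\Omega$, $\phi\in C^2(\Omega)$, $\phi(x_0)=v(x_0)$ and $\phi(x)<v(x)$ for all $x\in\Omega\setminus\{x_0\}$. An upper semicontinuous $u:\Omega\to[-\infty,\infty)$ is a viscosity subsolution if $\Delta_\infty\psi(x_0)\ge F(x_0)$ whenever $x_0\in\Omega$, $\psi\in C^2(\Omega)$, $\psi(x_0)=u(x_0)$ and $\psi(x)>u(x)$ for all $x\in\Omega\setminus\{x_0\}$. A viscosity solution is a (finite) continuous function on $\Omega$ that is both. Let $$\overline H(x)=\inf_{v\in\mathfrak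 U}v(x),\qquad \underline H(x)=\sup_{u\in\mathfrak L}u(x)\qquad(x\in\Omega),$$ where $\mathfrak U$ is the class of all viscosity supersolutions $v$ in $\Omega$ with $\liminf_{x\to\xi}v(x)\ge g(\xi)$ for every $\xi\in\partial\Omega$, and $\mathfrak L$ is the class of all viscosity subsolutions $u$ in $\Omega$ with $\limsup_{x\to\xi}u(x)\le g(\xi)$ for every $\xi\in\partial\Omega$ (the limits are taken with $x\in\Omega$). Theorem. 1. $\overline H$ and $\underline H$ are viscosity solutions of $\Delta_\infty h=F$ in $\Omega$, and $\lim_{x\to\xi}\overline H(x)=g(\xi)=\lim_{x\to\xi}\underline H(x)$ for every $\xi\in\partial\Omega$. 2. Every viscosity solution $h$ of $\Delta_\infty h=F$ in $\Omega$ with $\lim_{x\to\xi}h(x)=g(\xi)$ for every $\xi\in\partial\Omega$ satisfies $\overline H\le h\le\underline H$ in $\Omega$. 3. If $F$ is bounded away from $0$ (there is $c>0$ with $|F|\ge c$ in $\Omega$) or $F\equiv0$ in $\Omega$, then $\overline H=\underline H$ in $\Omega$, and any two viscosity solutions of $\Delta_\infty h=F$ in $\Omega$ with boundary values $g$ (in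 the sense of part 2) coincide in $\Omega$. -/

import Mathlib

open Filter Topology

noncomputable section

namespace InfPoisson

/-- The partial derivative `∂φ/∂xᵢ` at `x`. -/
def partialDeriv {n : ℕ} (i : Fin n) (φ : EuclideanSpace ℝ (Fin n) → ℝ)
    (x : EuclideanSpace ℝ (Fin n)) : ℝ :=
  fderiv ℝ φ x (EuclideanSpace.single i 1)

/-- The `∞`-Laplacian `Δ_∞ φ = ∑ᵢⱼ φ_{xᵢ} φ_{xⱼ} φ_{xᵢxⱼ}` at `x`. -/
def infLaplacian {n : ℕ} (φ : EuclideanSpace ℝ (Fin n) → ℝ)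
    (x : EuclideanSpace ℝ (Fin n)) : ℝ :=
  ∑ i, ∑ j, partialDeriv i φ x * partialDeriv j φ x * partialDeriv i (partialDeriv j φ) x

/-- `φ` touches `v` (strictly) from below at `x₀`, relative to `Ω`. -/
def TouchesFromBelow {n : ℕ} (Ω : Set (EuclideanSpace ℝ (Fin n)))
    (φ : EuclideanSpace ℝ (Fin n) → ℝ) (v : EuclideanSpace ℝ (Fin n) → EReal)
    (x₀ : EuclideanSpace ℝ (Fin n)) : Prop :=
  v x₀ = (φ x₀ : EReal) ∧ ∀ x ∈ Ω, x ≠ x₀ → (φ x : EReal) < v x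

/-- `ψ` touches `u` (strictly) from above at `x₀`, relative to `Ω`. -/
def TouchesFromAbove {n : ℕ} (Ω : Set (EuclideanSpace ℝ (Fin n)))
    (ψ : EuclideanSpace ℝ (Fin n) → ℝ) (u : EuclideanSpace ℝ (Fin n) → EReal)
    (x₀ : EuclideanSpace ℝ (Fin n)) : Prop :=
  u x₀ = (ψ x₀ : EReal) ∧ ∀ x ∈ Ω, x ≠ x₀ → u x < (ψ x : EReal)

/-- Viscosity supersolutions of `Δ_∞ v = F` in `Ω`: lower semicontinuous functions with values
in `(-∞, ∞]`. Only the values of `v` and `F` on `Ω` matter. -/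
structure IsViscositySupersolution {n : ℕ} (Ω : Set (EuclideanSpace ℝ (Fin n)))
    (F : EuclideanSpace ℝ (Fin n) → ℝ) (v : EuclideanSpace ℝ (Fin n) → EReal) : Prop where
  ne_bot : ∀ x ∈ Ω, v x ≠ ⊥
  lsc : LowerSemicontinuousOn v Ω
  le_of_touches : ∀ x₀ ∈ Ω, ∀ φ : EuclideanSpace ℝ (Fin n) → ℝ, ContDiffOn ℝ 2 φ Ω →
    TouchesFromBelow Ω φ v x₀ → infLaplacian φ x₀ ≤ F x₀

/-- Viscosity subsolutions of `Δ_∞ u = F` in `Ω`: upper semicontinuous functions with values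
in `[-∞, ∞)`. -/
structure IsViscositySubsolution {n : ℕ} (Ω : Set (EuclideanSpace ℝ (Fin n)))
    (F : EuclideanSpace ℝ (Fin n) → ℝ) (u : EuclideanSpace ℝ (Fin n) → EReal) : Prop where
  ne_top : ∀ x ∈ Ω, u x ≠ ⊤
  usc : UpperSemicontinuousOn u Ω
  ge_of_touches : ∀ x₀ ∈ Ω, ∀ ψ : EuclideanSpace ℝ (Fin n) → ℝ, ContDiffOn ℝ 2 ψ Ω →
    TouchesFromAbove Ω ψ u x₀ → F x₀ ≤ infLaplacian ψ x₀

/-- Viscosity solutions of `Δ_∞ h = F` in `Ω`: continuous functions that are both viscosity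
supersolutions and viscosity subsolutions. Such `h` is finite on `Ω`, since a supersolution
omits the value `-∞` and a subsolution omits the value `+∞`. -/
structure IsViscositySolution {n : ℕ} (Ω : Set (EuclideanSpace ℝ (Fin n)))
    (F : EuclideanSpace ℝ (Fin n) → ℝ) (h : EuclideanSpace ℝ (Fin n) → EReal) : Prop where
  continuousOn : ContinuousOn h Ω
  supersolution : IsViscositySupersolution Ω F h
  subsolution : IsViscositySubsolution Ω F h

/-- `h` takes the boundary values `g` in the classical sense at every boundary point of `Ω`. -/
def HasBoundaryValues {n : ℕ} (Ω : Set (EuclideanSpace ℝ (Fin n)))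
    (g : EuclideanSpace ℝ (Fin n) → ℝ) (h : EuclideanSpace ℝ (Fin n) → EReal) : Prop :=
  ∀ ξ ∈ frontier Ω, Tendsto h (𝓝[Ω] ξ) (𝓝 (g ξ : EReal))

/-- The Perron upper class. -/
def upperClass {n : ℕ} (Ω : Set (EuclideanSpace ℝ (Fin n)))
    (F g : EuclideanSpace ℝ (Fin n) → ℝ) : Set (EuclideanSpace ℝ (Fin n) → EReal) :=
  {v | IsViscositySupersolution Ω F v ∧ ∀ ξ ∈ frontier Ω, (g ξ : EReal) ≤ liminf v (𝓝[Ω] ξ)}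

/-- The Perron lower class. -/
def lowerClass {n : ℕ} (Ω : Set (EuclideanSpace ℝ (Fin n)))
    (F g : EuclideanSpace ℝ (Fin n) → ℝ) : Set (EuclideanSpace ℝ (Fin n) → EReal) :=
  {u | IsViscositySubsolution Ω F u ∧ ∀ ξ ∈ frontier Ω, limsup u (𝓝[Ω] ξ) ≤ (g ξ : EReal)}

/-- The upper Perron solution: the pointwise infimum (in `[-∞, ∞]`) over the upper class. -/
def upperPerron {n : ℕ} (Ω : Set (EuclideanSpace ℝ (Fin n)))
    (F g : EuclideanSpace ℝ (Fin n) → ℝ) (x : EuclideanSpace ℝ (Fin n)) : EReal :=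
  ⨅ v ∈ upperClass Ω F g, v x

/-- The lower Perron solution: the pointwise supremum (in `[-∞, ∞]`) over the lower class. -/
def lowerPerron {n : ℕ} (Ω : Set (EuclideanSpace ℝ (Fin n)))
    (F g : EuclideanSpace ℝ (Fin n) → ℝ) (x : EuclideanSpace ℝ (Fin n)) : EReal :=
  ⨆ u ∈ lowerClass Ω F g, u x

end InfPoisson

end

/-!
A quadratic cone `A + B ‖x - ξ‖ + C ‖x - ξ‖ ^ 2` has `Δ_∞ = 2 C (B + 2 C ‖x - ξ‖) ^ 2`, so for
`C = ± 1` and `|B|` large it is a strict sub- or supersolution. With vertices at boundary points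
such cones are barriers: they bound the upper functions and force the boundary values.
Supersolutions are locally Lipschitz by comparison with cones, so the infimum of the upper functions
is a continuous supersolution. If it failed to be a subsolution, lowering it near the contact point
of a test function would give a smaller upper function. The substitution `h ↦ -h`, which changes
`(F, g)` to `(-F, -g)`, carries everything over to the lower Perron solution.

For uniqueness, maximise `u x - v y` over the pairs with `dist x y ≤ R`, and among the maximal pairs
choose `(x₀, y₀)` with `u x₀` largest. If `M s` and `N s` are the maxima of `u` and `-v` over the
closed ball of radius `s` about the midpoint `z` of this pair, then `M s + N t ≤ u x₀ - v y₀` for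
`s + t = R`.
* If `Δ_∞ u ≥ f₁ > f₂ ≥ Δ_∞ v` with `f₁ > 0`, comparison with parabolas in the radius contradicts
  this inequality for some radii close to `s = t = R / 2`.
* If `Δ_∞ u ≥ 0 ≥ Δ_∞ v`, comparison with cones puts `M` and `N` below their chords, which forces
  `u z = u x₀` and `v z = v y₀`. The points where these equalities hold form a nonempty clopen set,
  which cannot be bounded.
* The operator is homogeneous of degree `3`, so for `F > 0` the function `(1 + ε) u` is a strict
  subsolution, and comparison follows from the first case as `ε → 0`.

When `{F = 0}` is open, the three sets `{F > 0}`, `{F < 0}` and `{F = 0}` have their frontiers in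
that of `Ω`, and comparison holds on each.
-/

namespace InfPoisson

open Set Metric

variable {n : ℕ}

local notation "𝔼" => EuclideanSpace ℝ (Fin n)

/-! ### Second derivatives -/

section SecondDerivative

variable {E G : Type*} [NormedAddCommGroup E] [NormedSpace ℝ E] [NormedAddCommGroup G]
  [NormedSpace ℝ G]

lemma differentiableAt_fderiv_of_contDiffAt {f : E → G} {x : E} (hf : ContDiffAt ℝ 2 f x) :
    DifferentiableAt ℝ (fderiv ℝ f) x :=
  (hf.fderiv_right (m := 1) (by norm_num)).differentiableAt one_ne_zero

lemma eventually_differentiableAt_of_contDiffAt {f : E → G} {x : E} (hf : ContDiffAt ℝ 2 f x) :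
    ∀ᶠ y in 𝓝 x, DifferentiableAt ℝ f y :=
  (hf.eventually (by simp)).mono fun _ hy => hy.differentiableAt two_ne_zero

lemma fderiv_fderiv_add {f g : E → G} {x : E} (hf : ContDiffAt ℝ 2 f x)
    (hg : ContDiffAt ℝ 2 g x) :
    fderiv ℝ (fderiv ℝ (f + g)) x = fderiv ℝ (fderiv ℝ f) x + fderiv ℝ (fderiv ℝ g) x := by
  have h : fderiv ℝ (f + g) =ᶠ[𝓝 x] fderiv ℝ f + fderiv ℝ g := by
    filter_upwards [eventually_differentiableAt_of_contDiffAt hf,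
      eventually_differentiableAt_of_contDiffAt hg] with y hfy hgy using fderiv_add hfy hgy
  rw [h.fderiv_eq, fderiv_add (differentiableAt_fderiv_of_contDiffAt hf)
    (differentiableAt_fderiv_of_contDiffAt hg)]

lemma fderiv_fderiv_sub {f g : E → G} {x : E} (hf : ContDiffAt ℝ 2 f x)
    (hg : ContDiffAt ℝ 2 g x) :
    fderiv ℝ (fderiv ℝ (f - g)) x = fderiv ℝ (fderiv ℝ f) x - fderiv ℝ (fderiv ℝ g) x := by
  have h : fderiv ℝ (f - g) =ᶠ[𝓝 x] fderiv ℝ f - fderiv ℝ g := by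
    filter_upwards [eventually_differentiableAt_of_contDiffAt hf,
      eventually_differentiableAt_of_contDiffAt hg] with y hfy hgy using fderiv_sub hfy hgy
  rw [h.fderiv_eq, fderiv_sub (differentiableAt_fderiv_of_contDiffAt hf)
    (differentiableAt_fderiv_of_contDiffAt hg)]

lemma hasFDerivAt_fderiv_apply {f : E → G} {x : E} (hf : ContDiffAt ℝ 2 f x) (p : E) :
    HasFDerivAt (fun y => fderiv ℝ f y p) ((fderiv ℝ (fderiv ℝ f) x).flip p) x := by
  simpa using (differentiableAt_fderiv_of_contDiffAt hf).hasFDerivAt.clm_apply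
    (hasFDerivAt_const p x)

lemma deriv_deriv_nonneg_of_isLocalMin {f : ℝ → ℝ} {a : ℝ} (hf : ContinuousAt f a)
    (h : IsLocalMin f a) : 0 ≤ deriv (deriv f) a := by
  by_contra! hneg
  have hmax : IsLocalMax f a := isLocalMax_of_deriv_deriv_neg hneg h.deriv_eq_zero hf
  have hconst : f =ᶠ[𝓝 a] fun _ => f a := by
    filter_upwards [h, hmax] with x h₁ h₂ using le_antisymm h₂ h₁
  rw [hconst.deriv.deriv_eq] at hneg
  simp at hneg

lemma fderiv_fderiv_nonneg_of_isLocalMin {f : E → ℝ} {x : E} (hf : ContDiffAt ℝ 2 f x)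
    (h : IsLocalMin f x) (p : E) : 0 ≤ fderiv ℝ (fderiv ℝ f) x p p := by
  have hline : ∀ t : ℝ, HasDerivAt (fun s : ℝ => x + s • p) p t := fun t => by
    simpa using ((hasDerivAt_id t).smul_const p).const_add x
  have htendsto : Tendsto (fun s : ℝ => x + s • p) (𝓝 0) (𝓝 x) := by
    simpa using (hline 0).continuousAt.tendsto
  have hderiv : ∀ᶠ t : ℝ in 𝓝 0,
      HasDerivAt (fun s : ℝ => f (x + s • p)) (fderiv ℝ f (x + t • p) p) t :=
    (htendsto.eventually (eventually_differentiableAt_of_contDiffAt hf)).mono fun t ht =>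
      ht.hasFDerivAt.comp_hasDerivAt t (hline t)
  have hderiv₂ : deriv (deriv fun s : ℝ => f (x + s • p)) 0 = fderiv ℝ (fderiv ℝ f) x p p := by
    have hder : (deriv fun s : ℝ => f (x + s • p)) =ᶠ[𝓝 0] fun t => fderiv ℝ f (x + t • p) p :=
      hderiv.mono fun t ht => ht.deriv
    rw [hder.deriv_eq]
    exact ((hasFDerivAt_fderiv_apply hf p).comp_hasDerivAt_of_eq 0 (hline 0) (by simp)).deriv
  rw [← hderiv₂]
  refine deriv_deriv_nonneg_of_isLocalMin hderiv.self_of_nhds.continuousAt ?_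
  filter_upwards [htendsto.eventually h] with t ht
  simpa using ht

end SecondDerivative

section HilbertSpace

variable {E : Type*} [NormedAddCommGroup E] [InnerProductSpace ℝ E]

lemma contDiff_norm_sub_pow_four (x : E) : ContDiff ℝ 2 fun y : E => ‖y - x‖ ^ 4 := by
  have h : ContDiff ℝ 2 fun y : E => (‖y - x‖ ^ 2) ^ 2 :=
    ((contDiff_id.sub contDiff_const).norm_sq ℝ).pow 2
  simpa only [← pow_mul] using h

lemma hasFDerivAt_norm_sub_sq (x y : E) :
    HasFDerivAt (fun y : E => ‖y - x‖ ^ 2) ((2 : ℝ) • innerSL ℝ (y - x)) y := by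
  simpa [ofNat_smul_eq_nsmul] using ((hasFDerivAt_id (𝕜 := ℝ) y).sub_const x).norm_sq

lemma hasFDerivAt_norm_sub {x y : E} (hy : y ≠ x) :
    HasFDerivAt (fun y : E => ‖y - x‖) (‖y - x‖⁻¹ • innerSL ℝ (y - x)) y := by
  have hpos : 0 < ‖y - x‖ := norm_pos_iff.2 (sub_ne_zero.2 hy)
  have h := (hasFDerivAt_norm_sub_sq x y).sqrt (by positivity)
  simp only [Real.sqrt_sq (norm_nonneg _), smul_smul] at h
  convert h using 2
  field_simp

lemma hasFDerivAt_norm_sub_pow_four (x y : E) :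
    HasFDerivAt (fun y : E => ‖y - x‖ ^ 4) ((4 * ‖y - x‖ ^ 2) • innerSL ℝ (y - x)) y := by
  have h := (hasFDerivAt_norm_sub_sq x y).pow 2
  simp only [← pow_mul] at h
  refine HasFDerivAt.congr_fderiv h ?_
  rw [smul_smul]
  congr 1
  norm_num
  ring

lemma fderiv_norm_sub_pow_four_self (x : E) : fderiv ℝ (fun y : E => ‖y - x‖ ^ 4) x = 0 := by
  simp [(hasFDerivAt_norm_sub_pow_four x x).fderiv]

lemma fderiv_fderiv_norm_sub_pow_four_self (x : E) :
    fderiv ℝ (fderiv ℝ fun y : E => ‖y - x‖ ^ 4) x = 0 := by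
  have h : fderiv ℝ (fun y : E => ‖y - x‖ ^ 4)
      = fun y => (4 * ‖y - x‖ ^ 2) • innerSL ℝ (y - x) :=
    funext fun y => (hasFDerivAt_norm_sub_pow_four x y).fderiv
  have hinner : HasFDerivAt (fun y : E => innerSL ℝ (y - x)) (innerSL ℝ : E →L[ℝ] _) x :=
    (innerSL ℝ : E →L[ℝ] _).hasFDerivAt.comp x ((hasFDerivAt_id x).sub_const x)
  rw [h, (((hasFDerivAt_norm_sub_sq x x).const_mul 4).fun_smul hinner).fderiv]
  simp

variable [CompleteSpace E]

lemma hasFDerivAt_norm_gradient_sq {φ : E → ℝ} {x : E} (hφ : ContDiffAt ℝ 2 φ x) :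
    HasFDerivAt (fun y => ‖gradient φ y‖ ^ 2)
      ((2 : ℝ) • (fderiv ℝ (fderiv ℝ φ) x).flip (gradient φ x)) x := by
  have hgrad : HasFDerivAt (gradient φ)
      ((InnerProductSpace.toDual ℝ E).symm.toContinuousLinearEquiv.toContinuousLinearMap.comp
        (fderiv ℝ (fderiv ℝ φ) x)) x :=
    ((InnerProductSpace.toDual ℝ E).symm.toContinuousLinearEquiv.toContinuousLinearMap
      |>.hasFDerivAt).comp x (differentiableAt_fderiv_of_contDiffAt hφ).hasFDerivAt
  refine hgrad.norm_sq.congr_fderiv ?_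
  ext p
  have hinner : inner ℝ (gradient φ x)
      ((InnerProductSpace.toDual ℝ E).symm (fderiv ℝ (fderiv ℝ φ) x p))
      = fderiv ℝ (fderiv ℝ φ) x p (gradient φ x) := by
    rw [real_inner_comm, InnerProductSpace.toDual_symm_apply]
  simp [-inner_gradient_left, hinner]

end HilbertSpace

/-! ### The ∞-Laplacian of functions of class `C²` -/

lemma infLaplacian_eq_fderiv_fderiv {φ : 𝔼 → ℝ} {x : 𝔼} (hφ : ContDiffAt ℝ 2 φ x) :
    infLaplacian φ x = fderiv ℝ (fderiv ℝ φ) x (gradient φ x) (gradient φ x) := by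
  have hsecond : ∀ i j, partialDeriv i (partialDeriv j φ) x
      = fderiv ℝ (fderiv ℝ φ) x (EuclideanSpace.single i 1) (EuclideanSpace.single j 1) :=
    fun i j => DFunLike.congr_fun
      (hasFDerivAt_fderiv_apply hφ (EuclideanSpace.single j 1)).fderiv (EuclideanSpace.single i 1)
  have hgrad : gradient φ x = ∑ i, partialDeriv i φ x • EuclideanSpace.single i (1 : ℝ) := by
    rw [← (EuclideanSpace.basisFun (Fin n) ℝ).sum_repr' (gradient φ x)]
    refine Finset.sum_congr rfl fun i _ => ?_
    rw [EuclideanSpace.basisFun_apply, real_inner_comm, inner_gradient_left, partialDeriv]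
  rw [infLaplacian, hgrad]
  simp only [map_sum, map_smul, sum_apply, smul_apply, smul_eq_mul, Finset.mul_sum, hsecond]
  rw [Finset.sum_comm]
  refine Finset.sum_congr rfl fun i _ => Finset.sum_congr rfl fun j _ => ?_
  ring

lemma infLaplacian_eq_fderiv_norm_gradient_sq {φ : 𝔼 → ℝ} {x : 𝔼} (hφ : ContDiffAt ℝ 2 φ x) :
    infLaplacian φ x = fderiv ℝ (fun y => ‖gradient φ y‖ ^ 2) x (gradient φ x) / 2 := by
  rw [infLaplacian_eq_fderiv_fderiv hφ, (hasFDerivAt_norm_gradient_sq hφ).fderiv]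
  simp

lemma infLaplacian_le_of_eventually_le {φ ψ : 𝔼 → ℝ} {x : 𝔼} (hφ : ContDiffAt ℝ 2 φ x)
    (hψ : ContDiffAt ℝ 2 ψ x) (heq : φ x = ψ x) (hle : ∀ᶠ y in 𝓝 x, φ y ≤ ψ y) :
    infLaplacian φ x ≤ infLaplacian ψ x := by
  have hmin : IsLocalMin (ψ - φ) x := by
    filter_upwards [hle] with y hy
    simpa [heq] using hy
  have hfderiv : fderiv ℝ ψ x = fderiv ℝ φ x := by
    rw [← sub_eq_zero, ← fderiv_sub (hψ.differentiableAt two_ne_zero)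
      (hφ.differentiableAt two_ne_zero), hmin.fderiv_eq_zero]
  have hhess : 0 ≤ fderiv ℝ (fderiv ℝ (ψ - φ)) x (gradient φ x) (gradient φ x) :=
    fderiv_fderiv_nonneg_of_isLocalMin (hψ.sub hφ) hmin _
  rw [fderiv_fderiv_sub hψ hφ] at hhess
  have hgrad : gradient ψ x = gradient φ x := by rw [gradient, hfderiv, gradient]
  rw [infLaplacian_eq_fderiv_fderiv hφ, infLaplacian_eq_fderiv_fderiv hψ, hgrad]
  simpa using hhess

lemma infLaplacian_congr {φ ψ : 𝔼 → ℝ} {x : 𝔼} (h : φ =ᶠ[𝓝 x] ψ) :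
    infLaplacian φ x = infLaplacian ψ x := by
  have hpartial : ∀ {χ₁ χ₂ : 𝔼 → ℝ} (i : Fin n), χ₁ =ᶠ[𝓝 x] χ₂ →
      partialDeriv i χ₁ =ᶠ[𝓝 x] partialDeriv i χ₂ := fun i hχ => by
    filter_upwards [hχ.fderiv (𝕜 := ℝ)] with y hy
    rw [partialDeriv, partialDeriv, hy]
  simp only [infLaplacian, (hpartial _ h).eq_of_nhds,
    (hpartial _ (hpartial _ h)).eq_of_nhds]

lemma infLaplacian_const (c : ℝ) (x : 𝔼) : infLaplacian (fun _ => c) x = 0 := by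
  simp [infLaplacian, partialDeriv]

lemma infLaplacian_const_mul (c : ℝ) (φ : 𝔼 → ℝ) (x : 𝔼) :
    infLaplacian (fun y => c * φ y) x = c ^ 3 * infLaplacian φ x := by
  have hpartial : ∀ (i : Fin n) (χ : 𝔼 → ℝ),
      partialDeriv i (fun y => c * χ y) = fun y => c * partialDeriv i χ y := fun i χ => by
    ext y
    rw [partialDeriv, show (fun y => c * χ y) = c • χ from rfl, fderiv_const_smul_field]
    rfl
  simp only [infLaplacian, hpartial, Finset.mul_sum]
  refine Finset.sum_congr rfl fun i _ => Finset.sum_congr rfl fun j _ => ?_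
  ring

lemma infLaplacian_neg (φ : 𝔼 → ℝ) (x : 𝔼) :
    infLaplacian (fun y => -φ y) x = -infLaplacian φ x := by
  simpa [Odd.neg_one_pow (by decide : Odd 3)] using infLaplacian_const_mul (-1) φ x

lemma infLaplacian_add_const (φ : 𝔼 → ℝ) (c : ℝ) (x : 𝔼) :
    infLaplacian (fun y => φ y + c) x = infLaplacian φ x := by
  have hpartial : ∀ i : Fin n, partialDeriv i (fun y => φ y + c) = partialDeriv i φ := fun i => by
    ext y
    rw [partialDeriv, partialDeriv, fderiv_add_const]
  simp only [infLaplacian, hpartial]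

lemma infLaplacian_add_of_fderiv_eq_zero {φ ψ : 𝔼 → ℝ} {x : 𝔼} (hφ : ContDiffAt ℝ 2 φ x)
    (hψ : ContDiffAt ℝ 2 ψ x) (h₁ : fderiv ℝ ψ x = 0) (h₂ : fderiv ℝ (fderiv ℝ ψ) x = 0) :
    infLaplacian (φ + ψ) x = infLaplacian φ x := by
  have hgrad : gradient (φ + ψ) x = gradient φ x := by
    rw [gradient, fderiv_add (hφ.differentiableAt two_ne_zero)
      (hψ.differentiableAt two_ne_zero), h₁, add_zero, gradient]
  rw [infLaplacian_eq_fderiv_fderiv (φ := φ + ψ) (hφ.add hψ),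
    infLaplacian_eq_fderiv_fderiv hφ, hgrad, fderiv_fderiv_add hφ hψ, h₂, add_zero]

lemma infLaplacian_add_norm_sub_pow_four {φ : 𝔼 → ℝ} {x : 𝔼} (hφ : ContDiffAt ℝ 2 φ x) :
    infLaplacian (fun y => φ y + ‖y - x‖ ^ 4) x = infLaplacian φ x :=
  infLaplacian_add_of_fderiv_eq_zero hφ (contDiff_norm_sub_pow_four x).contDiffAt
    (fderiv_norm_sub_pow_four_self x) (fderiv_fderiv_norm_sub_pow_four_self x)

lemma infLaplacian_sub_norm_sub_pow_four {φ : 𝔼 → ℝ} {x : 𝔼} (hφ : ContDiffAt ℝ 2 φ x) :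
    infLaplacian (fun y => φ y - ‖y - x‖ ^ 4) x = infLaplacian φ x := by
  have h := infLaplacian_add_norm_sub_pow_four
    (hφ.sub (contDiff_norm_sub_pow_four x).contDiffAt)
  simpa only [sub_add_cancel] using h.symm

lemma continuousAt_infLaplacian {φ : 𝔼 → ℝ} {x : 𝔼} (hφ : ContDiffAt ℝ 2 φ x) :
    ContinuousAt (infLaplacian φ) x := by
  have heq : (fun y => fderiv ℝ (fderiv ℝ φ) y (gradient φ y) (gradient φ y))
      =ᶠ[𝓝 x] infLaplacian φ :=
    (hφ.eventually (by simp)).mono fun y hy => (infLaplacian_eq_fderiv_fderiv hy).symm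
  have hd : ContDiffAt ℝ 1 (fderiv ℝ φ) x := hφ.fderiv_right (by norm_num)
  have hgrad : ContinuousAt (gradient φ) x :=
    (InnerProductSpace.toDual ℝ 𝔼).symm.continuous.continuousAt.comp hd.continuousAt
  have hhess : ContinuousAt (fderiv ℝ (fderiv ℝ φ)) x :=
    (hd.fderiv_right (m := 0) (by norm_num)).continuousAt
  exact ((hhess.clm_apply hgrad).clm_apply hgrad).congr heq

/-! ### Quadratic cones -/

/-- The radial function `A + B r + C r²` with `r = ‖x - z‖`, the model strict sub- or
supersolution away from its vertex `z`. -/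
def quadCone {E : Type*} [SeminormedAddCommGroup E] (A B C : ℝ) (z x : E) : ℝ :=
  A + B * ‖x - z‖ + C * ‖x - z‖ ^ 2

lemma continuous_quadCone {E : Type*} [SeminormedAddCommGroup E] (A B C : ℝ) (z : E) :
    Continuous (quadCone A B C z) := by
  unfold quadCone; fun_prop

section QuadCone

variable {E : Type*} [NormedAddCommGroup E] [InnerProductSpace ℝ E]

lemma contDiffAt_quadCone (A B C : ℝ) {z x : E} (hx : x ≠ z) :
    ContDiffAt ℝ 2 (quadCone A B C z) x := by
  have hnorm : ContDiffAt ℝ 2 (fun y : E => ‖y - z‖) x :=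
    (contDiffAt_id.sub contDiffAt_const).norm ℝ (sub_ne_zero.2 hx)
  exact (contDiffAt_const.add (contDiffAt_const.mul hnorm)).add (contDiffAt_const.mul (hnorm.pow 2))

variable [CompleteSpace E]

lemma gradient_quadCone (A B C : ℝ) {z x : E} (hx : x ≠ z) :
    gradient (quadCone A B C z) x = ((B + 2 * C * ‖x - z‖) / ‖x - z‖) • (x - z) := by
  have hr : ‖x - z‖ ≠ 0 := norm_ne_zero_iff.2 (sub_ne_zero.2 hx)
  refine HasGradientAt.gradient (hasGradientAt_iff_hasFDerivAt.2 ?_)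
  refine ((((hasFDerivAt_norm_sub hx).const_mul B).const_add A).add
    ((hasFDerivAt_norm_sub_sq z x).const_mul C)).congr_fderiv ?_
  ext w
  simp only [map_sub, add_apply, smul_apply, sub_apply, coe_innerSL_apply, smul_eq_mul, map_smul,
    InnerProductSpace.toDual_apply_apply]
  field_simp

lemma norm_gradient_quadCone_sq (A B C : ℝ) {z x : E} (hx : x ≠ z) :
    ‖gradient (quadCone A B C z) x‖ ^ 2 = quadCone (B ^ 2) (4 * B * C) (4 * C ^ 2) z x := by
  have hr : ‖x - z‖ ≠ 0 := norm_ne_zero_iff.2 (sub_ne_zero.2 hx)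
  rw [gradient_quadCone A B C hx, norm_smul, mul_pow, Real.norm_eq_abs, sq_abs, quadCone]
  field_simp
  ring

end QuadCone

lemma infLaplacian_quadCone (A B C : ℝ) {z x : 𝔼} (hx : x ≠ z) :
    infLaplacian (quadCone A B C z) x = 2 * C * (B + 2 * C * ‖x - z‖) ^ 2 := by
  have hr : ‖x - z‖ ≠ 0 := norm_ne_zero_iff.2 (sub_ne_zero.2 hx)
  have hsq : (fun y => ‖gradient (quadCone A B C z) y‖ ^ 2)
      =ᶠ[𝓝 x] quadCone (B ^ 2) (4 * B * C) (4 * C ^ 2) z :=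
    (eventually_ne_nhds hx).mono fun y hy => norm_gradient_quadCone_sq A B C hy
  rw [infLaplacian_eq_fderiv_norm_gradient_sq (contDiffAt_quadCone A B C hx), hsq.fderiv_eq,
    ← inner_gradient_left, gradient_quadCone _ _ _ hx, gradient_quadCone _ _ _ hx,
    real_inner_smul_left, real_inner_smul_right, real_inner_self_eq_norm_sq]
  field_simp
  ring

/-! ### Real-valued sub- and supersolutions -/

/-- Viscosity supersolutions of `Δ_∞ v = F` at the points of `Ω`, for real-valued `v` and with
test functions that are `C²` at the contact point and touch `v` there locally and not
necessarily strictly. No semicontinuity is included. -/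
def IsSupersolutionOn (Ω : Set 𝔼) (F v : 𝔼 → ℝ) : Prop :=
  ∀ x₀ ∈ Ω, ∀ φ : 𝔼 → ℝ, ContDiffAt ℝ 2 φ x₀ → φ x₀ = v x₀ → (∀ᶠ x in 𝓝 x₀, φ x ≤ v x) →
    infLaplacian φ x₀ ≤ F x₀

/-- Viscosity subsolutions, with the conventions of `IsSupersolutionOn`. -/
def IsSubsolutionOn (Ω : Set 𝔼) (F u : 𝔼 → ℝ) : Prop :=
  ∀ x₀ ∈ Ω, ∀ φ : 𝔼 → ℝ, ContDiffAt ℝ 2 φ x₀ → φ x₀ = u x₀ → (∀ᶠ x in 𝓝 x₀, u x ≤ φ x) →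
    F x₀ ≤ infLaplacian φ x₀

section BasicProperties

variable {Ω U : Set (EuclideanSpace ℝ (Fin n))} {F G u v w : EuclideanSpace ℝ (Fin n) → ℝ}

lemma IsSubsolutionOn.neg (h : IsSubsolutionOn Ω F u) : IsSupersolutionOn Ω (-F) (-u) := by
  intro x₀ hx₀ φ hφ heq hle
  have hneg := h x₀ hx₀ (fun x => -φ x) hφ.neg (by simp [heq])
    (hle.mono fun x hx => le_neg_of_le_neg hx)
  rw [infLaplacian_neg] at hneg
  exact le_neg_of_le_neg hneg

lemma IsSupersolutionOn.neg (h : IsSupersolutionOn Ω F v) : IsSubsolutionOn Ω (-F) (-v) := by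
  intro x₀ hx₀ φ hφ heq hle
  have hneg := h x₀ hx₀ (fun x => -φ x) hφ.neg (by simp [heq])
    (hle.mono fun x hx => neg_le_of_neg_le hx)
  rw [infLaplacian_neg] at hneg
  exact neg_le_of_neg_le hneg

lemma IsSupersolutionOn.mono (h : IsSupersolutionOn Ω F v) (hU : U ⊆ Ω)
    (hFG : ∀ x ∈ U, F x ≤ G x) : IsSupersolutionOn U G v :=
  fun x₀ hx₀ φ hφ heq hle => (h x₀ (hU hx₀) φ hφ heq hle).trans (hFG x₀ hx₀)

lemma IsSubsolutionOn.mono (h : IsSubsolutionOn Ω F u) (hU : U ⊆ Ω)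
    (hGF : ∀ x ∈ U, G x ≤ F x) : IsSubsolutionOn U G u :=
  fun x₀ hx₀ φ hφ heq hle => (hGF x₀ hx₀).trans (h x₀ (hU hx₀) φ hφ heq hle)

lemma IsSupersolutionOn.mono_set (h : IsSupersolutionOn Ω F v) (hU : U ⊆ Ω) :
    IsSupersolutionOn U F v :=
  h.mono hU fun _ _ => le_rfl

lemma IsSubsolutionOn.mono_set (h : IsSubsolutionOn Ω F u) (hU : U ⊆ Ω) :
    IsSubsolutionOn U F u :=
  h.mono hU fun _ _ => le_rfl

lemma IsSupersolutionOn.congr (h : IsSupersolutionOn Ω F v) (hΩ : IsOpen Ω) (hvw : EqOn v w Ω) :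
    IsSupersolutionOn Ω F w := fun x₀ hx₀ φ hφ heq hle =>
  h x₀ hx₀ φ hφ (heq.trans (hvw hx₀).symm) (by
    filter_upwards [hle, hΩ.mem_nhds hx₀] with x hx hxΩ using hx.trans_eq (hvw hxΩ).symm)

lemma IsSupersolutionOn.union (hΩ : IsSupersolutionOn Ω F v) (hU : IsSupersolutionOn U F v) :
    IsSupersolutionOn (Ω ∪ U) F v :=
  fun x₀ hx₀ => hx₀.elim (hΩ x₀) (hU x₀)

lemma IsSupersolutionOn.inf (hv : IsSupersolutionOn Ω F v) (hw : IsSupersolutionOn Ω F w) :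
    IsSupersolutionOn Ω F fun x => min (v x) (w x) := by
  intro x₀ hx₀ φ hφ heq hle
  rcases min_choice (v x₀) (w x₀) with h | h
  · exact hv x₀ hx₀ φ hφ (heq.trans h) (hle.mono fun x hx => hx.trans (min_le_left _ _))
  · exact hw x₀ hx₀ φ hφ (heq.trans h) (hle.mono fun x hx => hx.trans (min_le_right _ _))

lemma IsSubsolutionOn.const_mul (h : IsSubsolutionOn Ω F u) {c : ℝ} (hc : 0 < c) :
    IsSubsolutionOn Ω (fun x => c ^ 3 * F x) fun x => c * u x := by
  intro x₀ hx₀ φ hφ heq hle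
  have hscaled := h x₀ hx₀ (fun x => c⁻¹ * φ x) (contDiffAt_const.mul hφ) (by simp [heq, hc.ne'])
    (hle.mono fun x hx => (le_inv_mul_iff₀ hc).2 hx)
  rw [infLaplacian_const_mul] at hscaled
  calc c ^ 3 * F x₀ ≤ c ^ 3 * (c⁻¹ ^ 3 * infLaplacian φ x₀) := by gcongr
    _ = infLaplacian φ x₀ := by field_simp

lemma isSupersolutionOn_of_contDiffAt
    (h : ∀ x ∈ Ω, ContDiffAt ℝ 2 w x ∧ infLaplacian w x ≤ F x) : IsSupersolutionOn Ω F w :=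
  fun x₀ hx₀ _ hφ heq hle =>
    (infLaplacian_le_of_eventually_le hφ (h x₀ hx₀).1 heq hle).trans (h x₀ hx₀).2

end BasicProperties

/-! ### Comparison with functions of class `C²` -/

section StrictComparison

variable {K U : Set (EuclideanSpace ℝ (Fin n))} {F u v w : EuclideanSpace ℝ (Fin n) → ℝ}

lemma IsSubsolutionOn.lt_of_infLaplacian_lt (hK : IsCompact K) (hU : IsOpen U) (hUK : U ⊆ K)
    (hu : IsSubsolutionOn U F u) (husc : UpperSemicontinuousOn u K) (hw : ContinuousOn w K)
    (hwF : ∀ x ∈ U, ContDiffAt ℝ 2 w x ∧ infLaplacian w x < F x)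
    (hle : ∀ x ∈ K \ U, u x ≤ w x) : ∀ x ∈ U, u x < w x := by
  intro x₁ hx₁
  by_contra! hlt
  have no_max : ∀ y ∈ U, ¬ ∀ x ∈ K, u x - w x ≤ u y - w y := fun y hy hmax => by
    have htest := hu y hy (fun x => w x + (u y - w y)) ((hwF y hy).1.add contDiffAt_const)
      (by ring) (by
        filter_upwards [hU.mem_nhds hy] with x hx
        linarith [hmax x (hUK hx)])
    rw [infLaplacian_add_const] at htest
    exact htest.not_gt (hwF y hy).2
  obtain ⟨x₀, hx₀, hmax⟩ := (husc.add hw.neg.upperSemicontinuousOn).exists_isMaxOn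
    ⟨x₁, hUK hx₁⟩ hK
  have hmax₀ : ∀ x ∈ K, u x - w x ≤ u x₀ - w x₀ := fun x hx => hmax hx
  by_cases hx₀U : x₀ ∈ U
  · exact no_max x₀ hx₀U hmax₀
  · exact no_max x₁ hx₁ fun x hx => by linarith [hmax₀ x hx, hle x₀ ⟨hx₀, hx₀U⟩]

lemma upperSemicontinuousOn_neg {α : Type*} [TopologicalSpace α] {f : α → ℝ} {s : Set α}
    (hf : LowerSemicontinuousOn f s) : UpperSemicontinuousOn (-f) s :=
  continuous_neg.comp_lowerSemicontinuousOn_antitone hf fun _ _ => neg_le_neg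

lemma IsSupersolutionOn.lt_of_lt_infLaplacian (hK : IsCompact K) (hU : IsOpen U) (hUK : U ⊆ K)
    (hv : IsSupersolutionOn U F v) (hlsc : LowerSemicontinuousOn v K) (hw : ContinuousOn w K)
    (hwF : ∀ x ∈ U, ContDiffAt ℝ 2 w x ∧ F x < infLaplacian w x)
    (hle : ∀ x ∈ K \ U, w x ≤ v x) : ∀ x ∈ U, w x < v x := by
  intro x hx
  refine neg_lt_neg_iff.1 (hv.neg.lt_of_infLaplacian_lt (w := fun y => -w y) hK hU hUK
    (upperSemicontinuousOn_neg hlsc) hw.neg (fun y hy => ⟨(hwF y hy).1.neg, ?_⟩)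
    (fun y hy => neg_le_neg (hle y hy)) x hx)
  rw [infLaplacian_neg]
  exact neg_lt_neg (hwF y hy).2

end StrictComparison

section ConeComparison

variable {F u v : EuclideanSpace ℝ (Fin n) → ℝ} {z : EuclideanSpace ℝ (Fin n)} {A B C R : ℝ}

lemma IsSubsolutionOn.lt_quadCone_of_annulus {s₁ s₂ : ℝ} (hs₁ : 0 ≤ s₁)
    (hu : IsSubsolutionOn (ball z s₂ \ closedBall z s₁) F u)
    (husc : UpperSemicontinuousOn u (closedBall z s₂ \ ball z s₁))
    (hF : ∀ x ∈ ball z s₂ \ closedBall z s₁, 2 * C * (B + 2 * C * ‖x - z‖) ^ 2 < F x)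
    (h₁ : ∀ x ∈ sphere z s₁, u x ≤ A + B * s₁ + C * s₁ ^ 2)
    (h₂ : ∀ x ∈ sphere z s₂, u x ≤ A + B * s₂ + C * s₂ ^ 2) :
    ∀ x ∈ ball z s₂ \ closedBall z s₁, u x < quadCone A B C z x := by
  refine hu.lt_of_infLaplacian_lt ((isCompact_closedBall z s₂).diff isOpen_ball)
    (isOpen_ball.sdiff isClosed_closedBall)
    (sdiff_subset_sdiff ball_subset_closedBall ball_subset_closedBall) husc
    (continuous_quadCone A B C z).continuousOn (fun x hx => ?_) fun x hx => ?_
  · have hxz : x ≠ z := fun h => hx.2 (h ▸ mem_closedBall_self hs₁)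
    exact ⟨contDiffAt_quadCone A B C hxz, infLaplacian_quadCone A B C hxz ▸ hF x hx⟩
  · have hsphere : x ∈ sphere z s₁ ∨ x ∈ sphere z s₂ := by
      simp only [Set.mem_sdiff, mem_closedBall, mem_ball, not_lt, not_and, not_not,
        mem_sphere] at hx ⊢
      rcases hx.1.1.lt_or_eq with h | h
      · exact Or.inl ((hx.2 h).antisymm hx.1.2)
      · exact Or.inr h
    rcases hsphere with h | h
    · simpa only [quadCone, mem_sphere_iff_norm.1 h] using h₁ x h
    · simpa only [quadCone, mem_sphere_iff_norm.1 h] using h₂ x h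

lemma IsSubsolutionOn.le_quadCone (hu : IsSubsolutionOn (ball z R) F u)
    (husc : UpperSemicontinuousOn u (closedBall z R))
    (hF : ∀ x ∈ ball z R, 2 * C * (B + 2 * C * ‖x - z‖) ^ 2 < F x)
    (hz : u z ≤ A) (hR : ∀ x ∈ sphere z R, u x ≤ A + B * R + C * R ^ 2) :
    ∀ x ∈ closedBall z R, u x ≤ quadCone A B C z x := by
  intro x hx
  rcases eq_or_ne x z with rfl | hxz
  · simpa [quadCone] using hz
  rcases (mem_closedBall.1 hx).eq_or_lt with hxR | hxR
  · simpa only [quadCone, mem_sphere_iff_norm.1 hxR] using hR x hxR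
  refine (lt_quadCone_of_annulus le_rfl (hu.mono_set sdiff_subset) (husc.mono sdiff_subset)
    (fun y hy => hF y hy.1) (fun y hy => ?_) hR x ⟨hxR, ?_⟩).le
  · rw [sphere_zero, mem_singleton_iff] at hy
    simpa [hy] using hz
  · simpa using hxz

lemma IsSubsolutionOn.le_cone (hu : IsSubsolutionOn (ball z R) F u)
    (husc : UpperSemicontinuousOn u (closedBall z R)) (hF : ∀ x ∈ ball z R, 0 ≤ F x)
    (hB : 0 ≤ B) (hR : ∀ x ∈ sphere z R, u x ≤ u z + B * R) :
    ∀ x ∈ closedBall z R, u x ≤ u z + B * ‖x - z‖ := by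
  intro x hx
  have hcone : ∀ᶠ ε : ℝ in 𝓝[>] 0,
      u x ≤ u z + (B + 2 * ε * R) * ‖x - z‖ + -ε * ‖x - z‖ ^ 2 := by
    filter_upwards [self_mem_nhdsWithin] with ε hε
    have hεpos : 0 < ε := hε
    refine hu.le_quadCone husc (fun y hy => lt_of_lt_of_le ?_ (hF y hy)) le_rfl
      (fun y hy => (hR y hy).trans ?_) x hx
    · have hslope : 0 < B + 2 * ε * R + 2 * -ε * ‖y - z‖ := by
        have := mul_pos hεpos (sub_pos.2 (mem_ball_iff_norm.1 hy))
        linarith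
      nlinarith [pow_pos hslope 2]
    · nlinarith [mul_nonneg hεpos.le (sq_nonneg R)]
  have hlim : Tendsto (fun ε : ℝ => u z + (B + 2 * ε * R) * ‖x - z‖ + -ε * ‖x - z‖ ^ 2)
      (𝓝[>] 0) (𝓝 (u z + B * ‖x - z‖)) := by
    have hcont : Continuous fun ε : ℝ =>
        u z + (B + 2 * ε * R) * ‖x - z‖ + -ε * ‖x - z‖ ^ 2 := by fun_prop
    simpa using (hcont.tendsto 0).mono_left nhdsWithin_le_nhds
  exact ge_of_tendsto hlim hcone

lemma IsSupersolutionOn.sub_mul_norm_le {M : ℝ} (hR : 0 < R)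
    (hv : IsSupersolutionOn (ball z R) F v) (hlsc : LowerSemicontinuousOn v (closedBall z R))
    (hvM : ∀ x ∈ closedBall z R, |v x| ≤ M) (hF : ∀ x ∈ ball z R, F x ≤ C) :
    ∀ x ∈ closedBall z R, v z - (3 * R + |C| + 1 + 2 * M / R) * ‖x - z‖ ≤ v x := by
  set L := 3 * R + |C| + 1 + 2 * M / R with hL
  have hvz : |v z| ≤ M := hvM z (mem_closedBall_self hR.le)
  have hMR : 0 ≤ 2 * M / R := by
    have := (abs_nonneg _).trans hvz
    positivity
  have hLR : L * R = 3 * R ^ 2 + (|C| + 1) * R + 2 * M := by rw [hL]; field_simp; ring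
  have hcone := hv.neg.le_quadCone (A := -v z) (B := L) (C := -1)
    (upperSemicontinuousOn_neg hlsc) (fun x hx => ?_) le_rfl fun x hx => ?_
  · intro x hx
    have h := hcone x hx
    simp only [quadCone, Pi.neg_apply] at h
    linarith [sq_nonneg ‖x - z‖]
  · have hslope : |C| + 1 ≤ L + 2 * -1 * ‖x - z‖ := by
      linarith [mem_ball_iff_norm.1 hx]
    have hC := le_abs_self C
    have := hF x hx
    simp only [Pi.neg_apply]
    nlinarith [abs_nonneg C]
  · have hvx := hvM x (sphere_subset_closedBall hx)
    simp only [Pi.neg_apply]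
    nlinarith [neg_le_of_abs_le hvx, le_of_abs_le hvz, abs_nonneg C,
      mul_nonneg (abs_nonneg C) hR.le]

end ConeComparison

/-! ### Infima of families of supersolutions -/

section Families

variable {ι : Type*} {Ω K S U : Set (EuclideanSpace ℝ (Fin n))}
  {F h u v w : EuclideanSpace ℝ (Fin n) → ℝ} {V : ι → EuclideanSpace ℝ (Fin n) → ℝ}

lemma exists_strict_test_of_not_isSupersolutionOn (hΩ : IsOpen Ω) (hF : ContinuousOn F Ω)
    (hv : ¬ IsSupersolutionOn Ω F v) :
    ∃ x₀, ∃ q : 𝔼 → ℝ, ∃ r > 0, q x₀ = v x₀ ∧ ∀ x ∈ closedBall x₀ r,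
      x ∈ Ω ∧ (ContDiffAt ℝ 2 q x ∧ F x < infLaplacian q x) ∧ q x + ‖x - x₀‖ ^ 4 ≤ v x := by
  simp only [IsSupersolutionOn, not_forall, not_le] at hv
  obtain ⟨x₀, hx₀, φ, hφ, heq, hle, hlt⟩ := hv
  have hq : ContDiffAt ℝ 2 (fun x => φ x - ‖x - x₀‖ ^ 4) x₀ :=
    hφ.sub (contDiff_norm_sub_pow_four x₀).contDiffAt
  have hFq : F x₀ < infLaplacian (fun x => φ x - ‖x - x₀‖ ^ 4) x₀ := by
    rwa [infLaplacian_sub_norm_sub_pow_four hφ]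
  have hnear := (hΩ.eventually_mem hx₀).and (((hq.eventually (by simp)).and
    ((hF.continuousAt (hΩ.mem_nhds hx₀)).eventually_lt (continuousAt_infLaplacian hq) hFq)).and hle)
  obtain ⟨r, hr, hball⟩ := nhds_basis_closedBall.eventually_iff.1 hnear
  refine ⟨x₀, fun x => φ x - ‖x - x₀‖ ^ 4, r, hr, by simp [heq], fun x hx => ?_⟩
  obtain ⟨hxΩ, hxq, hxle⟩ := hball hx
  exact ⟨hxΩ, hxq, by simpa only [sub_add_cancel] using hxle⟩

lemma exists_strict_test_of_not_isSubsolutionOn (hΩ : IsOpen Ω) (hF : ContinuousOn F Ω)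
    (hu : ¬ IsSubsolutionOn Ω F u) :
    ∃ x₀, ∃ q : 𝔼 → ℝ, ∃ r > 0, q x₀ = u x₀ ∧ ∀ x ∈ closedBall x₀ r,
      x ∈ Ω ∧ (ContDiffAt ℝ 2 q x ∧ infLaplacian q x < F x) ∧ u x + ‖x - x₀‖ ^ 4 ≤ q x := by
  have hneg : ¬ IsSupersolutionOn Ω (-F) (-u) := fun hu' =>
    hu (by simpa only [neg_neg] using hu'.neg)
  obtain ⟨x₀, q, r, hr, heq, hq⟩ := exists_strict_test_of_not_isSupersolutionOn hΩ hF.neg hneg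
  refine ⟨x₀, fun x => -q x, r, hr, by simp [heq], fun x hx => ?_⟩
  obtain ⟨hxΩ, ⟨hqx, hFx⟩, hle⟩ := hq x hx
  rw [infLaplacian_neg]
  simp only [Pi.neg_apply] at hFx hle
  exact ⟨hxΩ, ⟨hqx.neg, by linarith⟩, by linarith⟩

lemma IsSupersolutionOn.iInf [Nonempty ι] (hΩ : IsOpen Ω) (hF : ContinuousOn F Ω)
    (hV : ∀ i, IsSupersolutionOn Ω F (V i)) (hlsc : ∀ i, LowerSemicontinuousOn (V i) Ω)
    (hbdd : ∀ x ∈ Ω, BddBelow (range fun i => V i x)) :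
    IsSupersolutionOn Ω F fun x => ⨅ i, V i x := by
  by_contra hnot
  obtain ⟨x₀, q, r, hr, heq, hq⟩ := exists_strict_test_of_not_isSupersolutionOn hΩ hF hnot
  have hr4 : (0 : ℝ) < r ^ 4 := by positivity
  obtain ⟨i, hi⟩ := exists_lt_of_ciInf_lt (lt_add_of_pos_right (⨅ i, V i x₀) hr4)
  have hcb : closedBall x₀ r ⊆ Ω := fun x hx => (hq x hx).1
  have hqV : q x₀ + r ^ 4 < V i x₀ :=
    ((hV i).mono_set (ball_subset_closedBall.trans hcb)).lt_of_lt_infLaplacian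
      (isCompact_closedBall x₀ r) isOpen_ball ball_subset_closedBall ((hlsc i).mono hcb)
      (w := fun x => q x + r ^ 4)
      (fun x hx => ((hq x hx).2.1.1.continuousAt.add continuousAt_const).continuousWithinAt)
      (fun x hx => by
        obtain ⟨hqx, hFx⟩ := (hq x (ball_subset_closedBall hx)).2.1
        exact ⟨hqx.add contDiffAt_const, by rwa [infLaplacian_add_const]⟩)
      (fun x hx => by
        have hxr : ‖x - x₀‖ = r := by
          rw [← dist_eq_norm]; exact le_antisymm hx.1 (not_lt.1 hx.2)
        have hqx := (hq x hx.1).2.2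
        rw [hxr] at hqx
        exact hqx.trans (ciInf_le (hbdd x (hcb hx.1)) i))
      x₀ (mem_ball_self hr)
  linarith

/-- Supersolutions with a common bound are locally Lipschitz with a common constant. -/
lemma continuousOn_iInf_of_isSupersolutionOn [Nonempty ι] {C M : ℝ} (hΩ : IsOpen Ω)
    (hFC : ∀ x ∈ Ω, F x ≤ C) (hV : ∀ i, IsSupersolutionOn Ω F (V i))
    (hlsc : ∀ i, LowerSemicontinuousOn (V i) Ω) (hVM : ∀ i, ∀ x ∈ Ω, |V i x| ≤ M) :
    ContinuousOn (fun x => ⨅ i, V i x) Ω := by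
  intro x₀ hx₀
  obtain ⟨ρ, hρ, hball⟩ := nhds_basis_closedBall.mem_iff.1 (hΩ.mem_nhds hx₀)
  set R := ρ / 2 with hR
  set L := 3 * R + |C| + 1 + 2 * M / R
  have hR0 : 0 < R := by positivity
  have hsub : ∀ x ∈ ball x₀ R, closedBall x R ⊆ Ω := fun x hx =>
    (closedBall_subset_closedBall' (by rw [mem_ball] at hx; linarith)).trans hball
  have hbdd : ∀ x ∈ Ω, BddBelow (range fun i => V i x) := fun x hx =>
    ⟨-M, by rintro _ ⟨i, rfl⟩; exact (abs_le.1 (hVM i x hx)).1⟩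
  have hlip : ∀ x ∈ ball x₀ R, ∀ y ∈ closedBall x R, (⨅ i, V i x) - L * ‖y - x‖ ≤ ⨅ i, V i y := by
    refine fun x hx y hy => le_ciInf fun i => ?_
    have hVi := ((hV i).mono_set (ball_subset_closedBall.trans (hsub x hx))).sub_mul_norm_le hR0
      ((hlsc i).mono (hsub x hx)) (fun z hz => hVM i z (hsub x hx hz))
      (fun z hz => hFC z (hsub x hx (ball_subset_closedBall hz))) y hy
    have hinf := ciInf_le (hbdd x (hsub x hx (mem_closedBall_self hR0.le))) i
    linarith
  refine (continuousAt_of_locally_lipschitz hR0 L fun y hy => ?_).continuousWithinAt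
  have hyx : y ∈ ball x₀ R := hy
  have h₁ := hlip x₀ (mem_ball_self hR0) y (ball_subset_closedBall hyx)
  have h₂ := hlip y hyx x₀ (mem_closedBall_comm.1 (ball_subset_closedBall hyx))
  rw [norm_sub_rev] at h₂
  rw [dist_eq_norm, dist_eq_norm, Real.norm_eq_abs, abs_le]
  constructor <;> linarith

lemma eqOn_piecewise_min {α : Type*} {K U : Set α} {v w : α → ℝ} [∀ x, Decidable (x ∈ U)]
    (hvw : ∀ x ∈ U \ K, v x ≤ w x) : EqOn v (U.piecewise (fun x => min (v x) (w x)) v) Kᶜ := by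
  intro x hx
  by_cases hxU : x ∈ U
  · rw [piecewise_eq_of_mem _ _ _ hxU, min_eq_left (hvw x ⟨hxU, hx⟩)]
  · rw [piecewise_eq_of_notMem _ _ _ hxU]

lemma IsSupersolutionOn.piecewise_min [∀ x, Decidable (x ∈ U)] (hU : IsOpen U) (hK : IsClosed K)
    (hKU : K ⊆ U) (hΩ : IsOpen Ω) (hUΩ : U ⊆ Ω) (hv : IsSupersolutionOn Ω F v)
    (hw : IsSupersolutionOn U F w) (hvw : ∀ x ∈ U \ K, v x ≤ w x) :
    IsSupersolutionOn Ω F (U.piecewise (fun x => min (v x) (w x)) v) := by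
  have hin := ((hv.mono_set hUΩ).inf hw).congr hU (piecewise_eqOn U _ v).symm
  have hout := (hv.mono_set sdiff_subset).congr (hΩ.sdiff hK)
    ((eqOn_piecewise_min hvw).mono fun x hx => hx.2)
  refine (hin.union hout).mono_set fun x hx => ?_
  by_cases hxK : x ∈ K
  · exact Or.inl (hKU hxK)
  · exact Or.inr ⟨hx, hxK⟩

lemma continuousOn_piecewise_min {α : Type*} [TopologicalSpace α] {K S U : Set α} {v w : α → ℝ}
    [∀ x, Decidable (x ∈ U)] (hU : IsOpen U) (hK : IsClosed K) (hKU : K ⊆ U)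
    (hv : ContinuousOn v S) (hw : ContinuousOn w U) (hvw : ∀ x ∈ U \ K, v x ≤ w x) :
    ContinuousOn (U.piecewise (fun x => min (v x) (w x)) v) S := by
  intro x hx
  by_cases hxK : x ∈ K
  · have hxU := hU.mem_nhds (hKU hxK)
    have hmin : ContinuousWithinAt (fun x => min (v x) (w x)) S x :=
      (hv x hx).min (hw.continuousAt hxU).continuousWithinAt
    exact hmin.congr_of_eventuallyEq_of_mem
      (mem_nhdsWithin_of_mem_nhds (mem_of_superset hxU (piecewise_eqOn U _ v))) hx
  · exact (hv x hx).congr_of_eventuallyEq_of_mem (mem_nhdsWithin_of_mem_nhds (mem_of_superset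
      (hK.isOpen_compl.mem_nhds hxK) (eqOn_piecewise_min hvw).symm)) hx

/-- Perron's bump: near the point where a test function `φ` violates the subsolution property,
replace `v` by its minimum with a slight downward shift of `φ`. -/
lemma IsSupersolutionOn.exists_lt_of_not_isSubsolutionOn (hΩ : IsOpen Ω) (hF : ContinuousOn F Ω)
    (hh : IsSupersolutionOn Ω F h) (hcont : ContinuousOn h S) (hnot : ¬ IsSubsolutionOn Ω F h) :
    ∃ v, IsSupersolutionOn Ω F v ∧ ContinuousOn v S ∧ EqOn v h Ωᶜ ∧ ∃ x ∈ Ω, v x < h x := by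
  classical
  obtain ⟨x₀, q, r, hr, heq, hq⟩ := exists_strict_test_of_not_isSubsolutionOn hΩ hF hnot
  have hq' := fun x hx => hq x (ball_subset_closedBall hx)
  set η := (r / 2) ^ 4 with hη
  have hη0 : 0 < η := by positivity
  have hK : closedBall x₀ (r / 2) ⊆ ball x₀ r := closedBall_subset_ball (by linarith)
  have hrΩ : ball x₀ r ⊆ Ω := fun x hx => (hq' x hx).1
  have hw : IsSupersolutionOn (ball x₀ r) F fun x => q x + -η :=
    isSupersolutionOn_of_contDiffAt fun x hx => by
      obtain ⟨hqx, hFx⟩ := (hq' x hx).2.1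
      exact ⟨hqx.add contDiffAt_const, by rw [infLaplacian_add_const]; exact hFx.le⟩
  have hwc : ContinuousOn (fun x => q x + -η) (ball x₀ r) := fun x hx =>
    ((hq' x hx).2.1.1.continuousAt.add continuousAt_const).continuousWithinAt
  have hle : ∀ x ∈ ball x₀ r \ closedBall x₀ (r / 2), h x ≤ q x + -η := by
    intro x hx
    have hηx : η ≤ ‖x - x₀‖ ^ 4 := by
      rw [hη, ← dist_eq_norm]
      have : r / 2 ≤ dist x x₀ := (not_le.1 hx.2).le
      gcongr
    linarith [(hq' x hx.1).2.2]
  refine ⟨(ball x₀ r).piecewise (fun x => min (h x) (q x + -η)) h,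
    hh.piecewise_min isOpen_ball isClosed_closedBall hK hΩ hrΩ hw hle,
    continuousOn_piecewise_min isOpen_ball isClosed_closedBall hK hcont hwc hle,
    fun x hx => piecewise_eq_of_notMem _ _ h fun hx' => hx (hrΩ hx'),
    x₀, hrΩ (mem_ball_self hr), ?_⟩
  rw [piecewise_eq_of_mem _ _ h (mem_ball_self hr)]
  exact (min_le_right _ _).trans_lt (by linarith)

end Families

/-! ### Perron's method -/

/-- The upper functions of Perron's method for `Δ_∞ v = F` in `Ω` with boundary data `g`; unlike
the members of `upperClass` they are real-valued, and defined up to the boundary. -/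
structure IsUpperFunction (Ω : Set 𝔼) (F g v : 𝔼 → ℝ) : Prop where
  lsc : LowerSemicontinuousOn v (closure Ω)
  isSupersolutionOn : IsSupersolutionOn Ω F v
  le_on_frontier : ∀ ξ ∈ frontier Ω, g ξ ≤ v ξ

/-- The pointwise infimum of the upper functions. -/
noncomputable def perronInf (Ω : Set 𝔼) (F g : 𝔼 → ℝ) (x : 𝔼) : ℝ :=
  ⨅ v : {v : 𝔼 → ℝ // IsUpperFunction Ω F g v}, v.1 x

/-- Solutions of the Dirichlet problem `Δ_∞ h = F` in `Ω`, `h = g` on the boundary, as real-valued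
functions that are continuous up to the boundary. -/
structure IsDirichletSolution (Ω : Set 𝔼) (F g h : 𝔼 → ℝ) : Prop where
  continuousOn : ContinuousOn h (closure Ω)
  isSupersolutionOn : IsSupersolutionOn Ω F h
  isSubsolutionOn : IsSubsolutionOn Ω F h
  eqOn_frontier : EqOn h g (frontier Ω)

section Perron

variable {Ω : Set (EuclideanSpace ℝ (Fin n))} {F g h v w : EuclideanSpace ℝ (Fin n) → ℝ}
  {a C S : ℝ} {ξ : EuclideanSpace ℝ (Fin n)}

lemma IsDirichletSolution.isUpperFunction (hh : IsDirichletSolution Ω F g h) :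
    IsUpperFunction Ω F g h :=
  ⟨hh.continuousOn.lowerSemicontinuousOn, hh.isSupersolutionOn,
    fun _ hξ => (hh.eqOn_frontier hξ).ge⟩

lemma IsDirichletSolution.neg (hh : IsDirichletSolution Ω F g h) :
    IsDirichletSolution Ω (-F) (-g) (-h) :=
  ⟨hh.continuousOn.neg, hh.isSubsolutionOn.neg, hh.isSupersolutionOn.neg,
    fun _ hξ => congrArg Neg.neg (hh.eqOn_frontier hξ)⟩

lemma IsUpperFunction.inf (hv : IsUpperFunction Ω F g v) (hw : IsUpperFunction Ω F g w) :
    IsUpperFunction Ω F g fun x => min (v x) (w x) :=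
  ⟨hv.lsc.inf hw.lsc, hv.isSupersolutionOn.inf hw.isSupersolutionOn,
    fun ξ hξ => le_min (hv.le_on_frontier ξ hξ) (hw.le_on_frontier ξ hξ)⟩

lemma IsUpperFunction.quadCone_le {A B : ℝ} (hΩ : IsOpen Ω) (hb : Bornology.IsBounded Ω)
    (hξ : ξ ∉ Ω) (hF : ∀ x ∈ Ω, F x < infLaplacian (quadCone A B C ξ) x)
    (hg : ∀ x ∈ frontier Ω, quadCone A B C ξ x ≤ g x) (hv : IsUpperFunction Ω F g v) :
    ∀ x ∈ closure Ω, quadCone A B C ξ x ≤ v x := by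
  have hbdry : ∀ x ∈ closure Ω \ Ω, quadCone A B C ξ x ≤ v x := by
    rw [← hΩ.frontier_eq]
    exact fun x hx => (hg x hx).trans (hv.le_on_frontier x hx)
  have hlt := hv.isSupersolutionOn.lt_of_lt_infLaplacian hb.isCompact_closure hΩ subset_closure
    hv.lsc (continuous_quadCone A B C ξ).continuousOn
    (fun x hx => ⟨contDiffAt_quadCone A B C (ne_of_mem_of_not_mem hx hξ), hF x hx⟩) hbdry
  intro x hx
  by_cases hxΩ : x ∈ Ω
  · exact (hlt x hxΩ).le
  · exact hbdry x ⟨hx, hxΩ⟩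

lemma exists_quadCone_barrier (hb : Bornology.IsBounded Ω) (hξ : ξ ∉ Ω) (hF : ∀ x ∈ Ω, C ≤ F x)
    (hS : ∀ x ∈ frontier Ω, g x ≤ S) (ha : ∀ᶠ x in 𝓝[frontier Ω] ξ, g x ≤ a) :
    ∃ B, (∀ x ∈ Ω, infLaplacian (quadCone a B (-1) ξ) x < F x) ∧
      ∀ x ∈ frontier Ω, g x ≤ quadCone a B (-1) ξ x := by
  obtain ⟨δ, hδ, hball⟩ := nhdsWithin_basis_ball.eventually_iff.1 ha
  obtain ⟨d, hd⟩ := hb.closure.subset_closedBall ξ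
  have hd' : ∀ x ∈ closure Ω, ‖x - ξ‖ ≤ d := fun x hx => by
    rw [← dist_eq_norm]; exact hd hx
  set s := |S - a| / δ with hs
  have hs0 : 0 ≤ s := by positivity
  refine ⟨2 * d + |C| + 1 + s, fun x hx => ?_, fun x hx => ?_⟩
  · rw [infLaplacian_quadCone _ _ _ (ne_of_mem_of_not_mem hx hξ)]
    have hslope : |C| + 1 ≤ 2 * d + |C| + 1 + s + 2 * (-1) * ‖x - ξ‖ := by
      linarith [hd' x (subset_closure hx)]
    nlinarith [hF x hx, neg_abs_le C, abs_nonneg C]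
  · have hxd := hd' x (frontier_subset_closure hx)
    have hr := norm_nonneg (x - ξ)
    have hcone : a + s * ‖x - ξ‖ ≤ quadCone a (2 * d + |C| + 1 + s) (-1) ξ x := by
      unfold quadCone
      nlinarith [abs_nonneg C]
    refine le_trans ?_ hcone
    by_cases hxδ : x ∈ ball ξ δ
    · exact (hball ⟨hxδ, hx⟩).trans (le_add_of_nonneg_right (by positivity))
    · rw [mem_ball, dist_eq_norm, not_lt] at hxδ
      have hδs : δ * s = |S - a| := by rw [hs]; field_simp
      nlinarith [hS x hx, le_abs_self (S - a)]

lemma exists_isUpperFunction_quadCone (hb : Bornology.IsBounded Ω) (hξ : ξ ∉ Ω)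
    (hF : ∀ x ∈ Ω, C ≤ F x) (hS : ∀ x ∈ frontier Ω, g x ≤ S)
    (ha : ∀ᶠ x in 𝓝[frontier Ω] ξ, g x ≤ a) :
    ∃ B, IsUpperFunction Ω F g (quadCone a B (-1) ξ) := by
  obtain ⟨B, hBF, hBg⟩ := exists_quadCone_barrier hb hξ hF hS ha
  exact ⟨B, (continuous_quadCone _ _ _ _).continuousOn.lowerSemicontinuousOn,
    isSupersolutionOn_of_contDiffAt fun x hx =>
      ⟨contDiffAt_quadCone _ _ _ (ne_of_mem_of_not_mem hx hξ), (hBF x hx).le⟩, hBg⟩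

lemma exists_quadCone_le_upperFunction (hΩ : IsOpen Ω) (hb : Bornology.IsBounded Ω) (hξ : ξ ∉ Ω)
    (hF : ∀ x ∈ Ω, F x ≤ C) (hS : ∀ x ∈ frontier Ω, S ≤ g x)
    (ha : ∀ᶠ x in 𝓝[frontier Ω] ξ, a ≤ g x) :
    ∃ B, ∀ v, IsUpperFunction Ω F g v → ∀ x ∈ closure Ω, quadCone a B 1 ξ x ≤ v x := by
  obtain ⟨B, hBF, hBg⟩ := exists_quadCone_barrier (F := -F) (g := -g) (a := -a) hb hξ
    (fun x hx => neg_le_neg (hF x hx)) (fun x hx => neg_le_neg (hS x hx))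
    (ha.mono fun x hx => neg_le_neg hx)
  have hneg : quadCone (-a) B (-1) ξ = fun x => -quadCone a (-B) 1 ξ x := by
    ext x; unfold quadCone; ring
  simp only [hneg, infLaplacian_neg, Pi.neg_apply, neg_lt_neg_iff, neg_le_neg_iff] at hBF hBg
  exact ⟨-B, fun v hv => hv.quadCone_le hΩ hb hξ hBF hBg⟩

lemma tendsto_of_quadCone_bounds {S : Set 𝔼}
    (hup : ∀ b > a, ∃ B C, ∀ x ∈ S, h x ≤ quadCone b B C ξ x)
    (hlow : ∀ b < a, ∃ B C, ∀ x ∈ S, quadCone b B C ξ x ≤ h x) :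
    Tendsto h (𝓝[S] ξ) (𝓝 a) := by
  have hlim : ∀ b B C, Tendsto (quadCone b B C ξ) (𝓝[S] ξ) (𝓝 b) := fun b B C => by
    have hcont := (continuous_quadCone b B C ξ).continuousWithinAt (s := S) (x := ξ)
    simpa [ContinuousWithinAt, quadCone] using hcont
  refine tendsto_order.2 ⟨fun c hc => ?_, fun c hc => ?_⟩
  · obtain ⟨b, hcb, hba⟩ := exists_between hc
    obtain ⟨B, C, hB⟩ := hlow b hba
    filter_upwards [(hlim b B C).eventually (lt_mem_nhds hcb), self_mem_nhdsWithin]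
      with x hx hxS using hx.trans_le (hB x hxS)
  · obtain ⟨b, hab, hbc⟩ := exists_between hc
    obtain ⟨B, C, hB⟩ := hup b hab
    filter_upwards [(hlim b B C).eventually (gt_mem_nhds hbc), self_mem_nhdsWithin]
      with x hx hxS using (hB x hxS).trans_lt hx

lemma exists_notMem_of_isBounded [NeZero n] (hb : Bornology.IsBounded Ω) : ∃ ξ, ξ ∉ Ω := by
  by_contra! h
  exact NormedSpace.unbounded_univ ℝ 𝔼 (eq_univ_of_forall h ▸ hb)

lemma exists_isUpperFunction_forall_le [NeZero n] (hb : Bornology.IsBounded Ω)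
    (hF : ∀ x ∈ Ω, C ≤ F x) (hg : ∀ x ∈ frontier Ω, g x ≤ S) :
    ∃ w, IsUpperFunction Ω F g w ∧ ∃ M, ∀ x ∈ closure Ω, w x ≤ M := by
  obtain ⟨ξ, hξ⟩ := exists_notMem_of_isBounded hb
  obtain ⟨B, hB⟩ := exists_isUpperFunction_quadCone hb hξ hF hg (eventually_mem_nhdsWithin.mono hg)
  obtain ⟨M, hM⟩ :=
    hb.isCompact_closure.bddAbove_image (continuous_quadCone S B (-1) ξ).continuousOn
  exact ⟨_, hB, M, fun x hx => hM (mem_image_of_mem _ hx)⟩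

lemma exists_forall_le_upperFunction [NeZero n] (hΩ : IsOpen Ω) (hb : Bornology.IsBounded Ω)
    (hF : ∀ x ∈ Ω, F x ≤ C) (hg : ∀ x ∈ frontier Ω, S ≤ g x) :
    ∃ m, ∀ v, IsUpperFunction Ω F g v → ∀ x ∈ closure Ω, m ≤ v x := by
  obtain ⟨ξ, hξ⟩ := exists_notMem_of_isBounded hb
  obtain ⟨B, hB⟩ :=
    exists_quadCone_le_upperFunction hΩ hb hξ hF hg (eventually_mem_nhdsWithin.mono hg)
  obtain ⟨m, hm⟩ := hb.isCompact_closure.bddBelow_image (continuous_quadCone S B 1 ξ).continuousOn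
  exact ⟨m, fun v hv x hx => (hm (mem_image_of_mem _ hx)).trans (hB v hv x hx)⟩

lemma bddBelow_upperFunctions [NeZero n] (hΩ : IsOpen Ω) (hb : Bornology.IsBounded Ω)
    (hF : ∀ x ∈ Ω, F x ≤ C) (hg : ∀ x ∈ frontier Ω, S ≤ g x) {x : 𝔼} (hx : x ∈ closure Ω) :
    BddBelow (range fun v : {v // IsUpperFunction Ω F g v} => v.1 x) := by
  obtain ⟨m, hm⟩ := exists_forall_le_upperFunction hΩ hb hF hg
  exact ⟨m, by rintro _ ⟨v, rfl⟩; exact hm v.1 v.2 x hx⟩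

lemma perronInf_le [NeZero n] (hΩ : IsOpen Ω) (hb : Bornology.IsBounded Ω)
    (hF : ∀ x ∈ Ω, F x ≤ C) (hg : ∀ x ∈ frontier Ω, S ≤ g x) (hv : IsUpperFunction Ω F g v)
    {x : 𝔼} (hx : x ∈ closure Ω) : perronInf Ω F g x ≤ v x :=
  ciInf_le (bddBelow_upperFunctions hΩ hb hF hg hx) ⟨v, hv⟩

lemma le_perronInf (hw : IsUpperFunction Ω F g w) {x : 𝔼}
    (h : ∀ v, IsUpperFunction Ω F g v → a ≤ v x) : a ≤ perronInf Ω F g x :=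
  have : Nonempty {v // IsUpperFunction Ω F g v} := ⟨⟨w, hw⟩⟩
  le_ciInf fun v => h v.1 v.2

lemma continuousOn_perronInf [NeZero n] (hΩ : IsOpen Ω) (hb : Bornology.IsBounded Ω)
    (hF : ∀ x ∈ Ω, |F x| ≤ C) (hg : ∀ x ∈ frontier Ω, |g x| ≤ S) :
    ContinuousOn (perronInf Ω F g) Ω := by
  obtain ⟨w, hw, M, hM⟩ := exists_isUpperFunction_forall_le hb
    (fun x hx => (abs_le.1 (hF x hx)).1) fun x hx => (abs_le.1 (hg x hx)).2
  obtain ⟨m, hm⟩ := exists_forall_le_upperFunction hΩ hb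
    (fun x hx => (abs_le.1 (hF x hx)).2) fun x hx => (abs_le.1 (hg x hx)).1
  have : Nonempty {v // IsUpperFunction Ω F g v} := ⟨⟨w, hw⟩⟩
  let V : {v // IsUpperFunction Ω F g v} → 𝔼 → ℝ := fun v x => min (v.1 x) (w x)
  have hV : ∀ v, IsUpperFunction Ω F g (V v) := fun v => v.2.inf hw
  have hVcont : ContinuousOn (fun x => ⨅ v, V v x) Ω := by
    refine continuousOn_iInf_of_isSupersolutionOn (M := max |m| |M|) hΩ
      (fun x hx => (abs_le.1 (hF x hx)).2) (fun v => (hV v).isSupersolutionOn)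
      (fun v => (hV v).lsc.mono subset_closure) fun v x hx => ?_
    exact abs_le_max_abs_abs (hm _ (hV v) x (subset_closure hx))
      ((min_le_right _ _).trans (hM x (subset_closure hx)))
  refine hVcont.congr fun x hx => le_antisymm (le_ciInf fun v => ?_) ?_
  · exact perronInf_le hΩ hb (fun x hx => (abs_le.1 (hF x hx)).2)
      (fun x hx => (abs_le.1 (hg x hx)).1) (hV v) (subset_closure hx)
  · exact ciInf_mono ⟨m, by rintro _ ⟨v, rfl⟩; exact hm _ (hV v) x (subset_closure hx)⟩
      fun v => min_le_left _ _

lemma tendsto_perronInf [NeZero n] (hΩ : IsOpen Ω) (hb : Bornology.IsBounded Ω)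
    (hF : ∀ x ∈ Ω, |F x| ≤ C) (hg : ∀ x ∈ frontier Ω, |g x| ≤ S) (hξ : ξ ∈ frontier Ω)
    (hgξ : ContinuousWithinAt g (frontier Ω) ξ) :
    Tendsto (perronInf Ω F g) (𝓝[closure Ω] ξ) (𝓝 (g ξ)) := by
  have hξΩ : ξ ∉ Ω := (hΩ.frontier_eq ▸ hξ : ξ ∈ closure Ω \ Ω).2
  have hFl := fun x hx => (abs_le.1 (hF x hx)).1
  have hFu := fun x hx => (abs_le.1 (hF x hx)).2
  have hgl := fun x hx => (abs_le.1 (hg x hx)).1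
  have hgu := fun x hx => (abs_le.1 (hg x hx)).2
  refine tendsto_of_quadCone_bounds (fun b hb' => ?_) fun b hb' => ?_
  · obtain ⟨B, hB⟩ := exists_isUpperFunction_quadCone hb hξΩ hFl hgu
      ((hgξ.eventually (gt_mem_nhds hb')).mono fun _ => le_of_lt)
    exact ⟨B, -1, fun x hx => perronInf_le hΩ hb hFu hgl hB hx⟩
  · obtain ⟨B, hB⟩ := exists_quadCone_le_upperFunction hΩ hb hξΩ hFu hgl
      ((hgξ.eventually (lt_mem_nhds hb')).mono fun _ => le_of_lt)
    obtain ⟨w, hw, -⟩ := exists_isUpperFunction_forall_le hb hFl hgu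
    exact ⟨B, 1, fun x hx => le_perronInf hw fun v hv => hB v hv x hx⟩

theorem isDirichletSolution_perronInf [NeZero n] (hΩ : IsOpen Ω) (hb : Bornology.IsBounded Ω)
    (hFc : ContinuousOn F Ω) (hF : ∀ x ∈ Ω, |F x| ≤ C) (hgc : ContinuousOn g (frontier Ω))
    (hg : ∀ x ∈ frontier Ω, |g x| ≤ S) : IsDirichletSolution Ω F g (perronInf Ω F g) := by
  have hFu := fun x hx => (abs_le.1 (hF x hx)).2
  have hgl := fun x hx => (abs_le.1 (hg x hx)).1
  obtain ⟨w, hw, -⟩ := exists_isUpperFunction_forall_le hb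
    (fun x hx => (abs_le.1 (hF x hx)).1) fun x hx => (abs_le.1 (hg x hx)).2
  have : Nonempty {v // IsUpperFunction Ω F g v} := ⟨⟨w, hw⟩⟩
  have hlim := fun ξ hξ => tendsto_perronInf hΩ hb hF hg hξ (hgc ξ hξ)
  have hbdry : EqOn (perronInf Ω F g) g (frontier Ω) := fun ξ hξ =>
    tendsto_nhds_unique (tendsto_pure_nhds _ ξ)
      ((hlim ξ hξ).mono_left (pure_le_nhdsWithin (frontier_subset_closure hξ)))
  have hcont : ContinuousOn (perronInf Ω F g) (closure Ω) := by
    rw [closure_eq_self_union_frontier]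
    rintro x (hx | hx) <;> rw [← closure_eq_self_union_frontier]
    · exact ((continuousOn_perronInf hΩ hb hF hg).continuousAt (hΩ.mem_nhds hx)).continuousWithinAt
    · simpa only [ContinuousWithinAt, hbdry hx] using hlim x hx
  have hsuper : IsSupersolutionOn Ω F (perronInf Ω F g) :=
    IsSupersolutionOn.iInf hΩ hFc (fun v => v.2.isSupersolutionOn)
      (fun v => v.2.lsc.mono subset_closure)
      fun x hx => bddBelow_upperFunctions hΩ hb hFu hgl (subset_closure hx)
  refine ⟨hcont, hsuper, ?_, hbdry⟩
  by_contra hnot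
  obtain ⟨v, hv, hvcont, hvh, x, hx, hlt⟩ :=
    hsuper.exists_lt_of_not_isSubsolutionOn hΩ hFc hcont hnot
  have hvU : IsUpperFunction Ω F g v :=
    ⟨hvcont.lowerSemicontinuousOn, hv, fun ξ hξ => by
      rw [hvh (hΩ.frontier_eq ▸ hξ : ξ ∈ closure Ω \ Ω).2, hbdry hξ]⟩
  exact hlt.not_ge (perronInf_le hΩ hb hFu hgl hvU (subset_closure hx))

end Perron

/-! ### Maxima over concentric balls -/

section BallMax

/-- The maximum of `u` over the closed ball of radius `s` about `z`, for `u` continuous there and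
`0 ≤ s`. -/
noncomputable def ballMax {α : Type*} [PseudoMetricSpace α] (u : α → ℝ) (z : α) (s : ℝ) : ℝ :=
  sSup (u '' closedBall z s)

section Metric

variable {α : Type*} [PseudoMetricSpace α] {u v : α → ℝ} {a s t M R : ℝ} {x z : α}

lemma ballMax_le (hs : 0 ≤ s) (h : ∀ x ∈ closedBall z s, u x ≤ a) : ballMax u z s ≤ a :=
  csSup_le ((nonempty_closedBall.2 hs).image u) (forall_mem_image.2 h)

variable [ProperSpace α]

lemma le_ballMax (hu : ContinuousOn u (closedBall z s)) (hx : x ∈ closedBall z s) :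
    u x ≤ ballMax u z s :=
  le_csSup ((isCompact_closedBall z s).bddAbove_image hu) (mem_image_of_mem u hx)

lemma exists_eq_ballMax (hs : 0 ≤ s) (hu : ContinuousOn u (closedBall z s)) :
    ∃ x ∈ closedBall z s, u x = ballMax u z s :=
  ((isCompact_closedBall z s).image_of_continuousOn hu).sSup_mem
    ((nonempty_closedBall.2 hs).image u)

lemma ballMax_add_ballMax_neg_le (hs : 0 ≤ s) (ht : 0 ≤ t) (hst : s + t = R)
    (hu : ContinuousOn u (closedBall z R)) (hv : ContinuousOn v (closedBall z R))
    (hmax : ∀ x ∈ closedBall z R, ∀ y ∈ closedBall z R, dist x y ≤ R → u x - v y ≤ M) :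
    ballMax u z s + ballMax (-v) z t ≤ M := by
  have hs' : closedBall z s ⊆ closedBall z R := closedBall_subset_closedBall (by linarith)
  have ht' : closedBall z t ⊆ closedBall z R := closedBall_subset_closedBall (by linarith)
  obtain ⟨x, hx, hxmax⟩ := exists_eq_ballMax hs (hu.mono hs')
  obtain ⟨y, hy, hymax⟩ := exists_eq_ballMax ht (hv.neg.mono ht')
  have hxy : dist x y ≤ R :=
    (dist_triangle_right x y z).trans ((add_le_add hx hy).trans_eq hst)
  rw [← hxmax, ← hymax, Pi.neg_apply, ← sub_eq_add_neg]
  exact hmax x (hs' hx) y (ht' hy) hxy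

end Metric

variable {F u v : EuclideanSpace ℝ (Fin n) → ℝ} {a b f₁ f₂ s t M R ρ : ℝ}
  {x₀ y₀ z : EuclideanSpace ℝ (Fin n)}

lemma IsSubsolutionOn.lt_ballMax (hR : 0 < R) (hu : IsSubsolutionOn (ball z R) F u)
    (huc : ContinuousOn u (closedBall z R)) (hF : 0 < F z) : u z < ballMax u z R := by
  by_contra! hle
  have htest := hu z (mem_ball_self hR) (fun _ => u z) contDiffAt_const rfl (by
    filter_upwards [closedBall_mem_nhds z hR] with x hx using (le_ballMax huc hx).trans hle)
  rw [infLaplacian_const] at htest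
  linarith

lemma IsSubsolutionOn.ballMax_le_chord (hR : 0 < R) (hs : 0 ≤ s) (hsR : s ≤ R)
    (hu : IsSubsolutionOn (ball z R) F u) (huc : ContinuousOn u (closedBall z R))
    (hF : ∀ x ∈ ball z R, 0 ≤ F x) :
    ballMax u z s ≤ u z + (ballMax u z R - u z) / R * s := by
  set B := (ballMax u z R - u z) / R with hB
  have hBR : B * R = ballMax u z R - u z := by rw [hB]; field_simp
  have hB0 : 0 ≤ B :=
    div_nonneg (sub_nonneg.2 (le_ballMax huc (mem_closedBall_self hR.le))) hR.le
  have hcone := hu.le_cone huc.upperSemicontinuousOn hF hB0 fun x hx => by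
    rw [hBR, add_sub_cancel]
    exact le_ballMax huc (sphere_subset_closedBall hx)
  refine ballMax_le hs fun x hx => (hcone x (closedBall_subset_closedBall hsR hx)).trans ?_
  rw [mem_closedBall, dist_eq_norm] at hx
  gcongr

/-- Compare with the parabola `σ ↦ ballMax u z ρ + a * σ + b / 2 * σ * (σ + t)` of
`σ = ‖x - z‖ - ρ`, which interpolates the bounds at `σ = -t, 0, t`. -/
lemma IsSubsolutionOn.lt_ballMax_add (ht : 0 < t) (htρ : t < ρ)
    (hu : IsSubsolutionOn (ball z (ρ + t)) F u) (huc : ContinuousOn u (closedBall z (ρ + t)))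
    (ha : 0 < a) (hab : 0 ≤ a + b * t / 2)
    (hF : ∀ x ∈ ball z (ρ + t), ∀ σ, |σ| < t → b * (a + b * (t / 2 + σ)) ^ 2 < F x)
    (hle : ballMax u z (ρ - t) ≤ ballMax u z ρ - a * t) :
    ballMax u z ρ + a * t + b * t ^ 2 < ballMax u z (ρ + t) := by
  by_contra! hle'
  have hc : ∀ {s}, s ≤ ρ + t → ContinuousOn u (closedBall z s) := fun h =>
    huc.mono (closedBall_subset_closedBall h)
  obtain ⟨x, hx, hxmax⟩ := exists_eq_ballMax (by linarith) (hc (show ρ ≤ ρ + t by linarith))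
  have hxρ : ‖x - z‖ ≤ ρ := by rwa [mem_closedBall, dist_eq_norm] at hx
  have hxt : ρ - t < ‖x - z‖ := by
    by_contra! h
    have hxle := le_ballMax (hc (by linarith)) (mem_closedBall_iff_norm.2 h)
    nlinarith
  have hlt := (hu.mono_set sdiff_subset).lt_quadCone_of_annulus (s₁ := ρ - t)
    (A := ballMax u z ρ - a * ρ + b / 2 * ρ * (ρ - t)) (B := a - b / 2 * (2 * ρ - t)) (C := b / 2)
    (by linarith) (huc.mono sdiff_subset).upperSemicontinuousOn
    (fun y hy => by
      have hy₂ := mem_ball_iff_norm.1 hy.1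
      have hy₁ : ρ - t < ‖y - z‖ := by simpa [dist_eq_norm] using hy.2
      calc 2 * (b / 2) * (a - b / 2 * (2 * ρ - t) + 2 * (b / 2) * ‖y - z‖) ^ 2
          = b * (a + b * (t / 2 + (‖y - z‖ - ρ))) ^ 2 := by ring
        _ < F y := hF y hy.1 _ (abs_lt.2 ⟨by linarith, by linarith⟩))
    (fun y hy => calc
      u y ≤ _ := le_ballMax (hc (by linarith)) (sphere_subset_closedBall hy)
      _ ≤ _ := hle
      _ = _ := by ring)
    (fun y hy => calc
      u y ≤ _ := le_ballMax huc (sphere_subset_closedBall hy)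
      _ ≤ _ := hle'
      _ = _ := by ring)
    x ⟨mem_ball_iff_norm.2 (by linarith), by simpa [dist_eq_norm] using hxt⟩
  have hslope : 0 ≤ a + b / 2 * (‖x - z‖ - ρ + t) := by
    rcases le_total 0 b with _ | _ <;> nlinarith
  rw [hxmax, quadCone] at hlt
  nlinarith [mul_nonneg hslope (sub_nonneg.2 hxρ)]

/-- For `b = f / a ^ 2` the quantity is `f * (1 + f * (t / 2 + σ) / a ^ 3) ^ 2`, which is close to
`f` uniformly in `a ≥ α`. -/
lemma exists_forall_slope_exists_curvature {α : ℝ} (hf : f₂ < f₁) (hf₁ : 0 < f₁) (hα : 0 < α)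
    (hρ : 0 < ρ) : ∃ t ∈ Ioo 0 ρ, ∀ a ≥ α, ∃ b > 0, ∀ σ, |σ| < t →
      b * (a + b * (t / 2 + σ)) ^ 2 ∈ Ioo f₂ f₁ := by
  obtain ⟨f, hlt, hff₁⟩ := exists_between (max_lt hf hf₁)
  obtain ⟨hf₂f, hf0⟩ := max_lt_iff.1 hlt
  have hcont : ContinuousAt (fun τ : ℝ => f * (1 + τ) ^ 2) 0 := by fun_prop
  obtain ⟨δ, hδ, hball⟩ := Metric.eventually_nhds_iff.1
    (hcont.eventually_mem (Ioo_mem_nhds (by simpa using hf₂f) (by simpa using hff₁)))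
  obtain ⟨t, ht, htlt⟩ := exists_between (show 0 < min ρ (δ * α ^ 3 / (2 * f)) by positivity)
  obtain ⟨htρ, htδ⟩ := lt_min_iff.1 htlt
  refine ⟨t, ⟨ht, htρ⟩, fun a ha => ⟨f / a ^ 2, ?_, fun σ hσ => ?_⟩⟩
  · have := hα.trans_le ha
    positivity
  · have ha0 : 0 < a := hα.trans_le ha
    have heq : f / a ^ 2 * (a + f / a ^ 2 * (t / 2 + σ)) ^ 2
        = f * (1 + f * (t / 2 + σ) / a ^ 3) ^ 2 := by field_simp
    rw [heq]
    refine hball ?_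
    have hσt : |t / 2 + σ| < 2 * t := abs_lt.2 (by constructor <;> linarith [abs_lt.1 hσ])
    rw [Real.dist_0_eq_abs, abs_div, abs_mul, abs_of_pos hf0, abs_of_pos (pow_pos ha0 3),
      div_lt_iff₀ (pow_pos ha0 3)]
    calc f * |t / 2 + σ| < f * (2 * t) := by gcongr
      _ < δ * α ^ 3 := by rw [lt_div_iff₀ (by positivity)] at htδ; linarith
      _ ≤ δ * a ^ 3 := by gcongr

/-- The bound on the drop of `ballMax u z` across `[ρ - t, ρ]` forces a rise across `[ρ, ρ + t]`;
hence `ballMax (-v) z` drops on the left, and then rises on the right, by too much. -/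
lemma IsSubsolutionOn.exists_ballMax_add_ballMax_neg_lt (hρ : 0 < ρ) (hf : f₂ < f₁) (hf₁ : 0 < f₁)
    (hu : IsSubsolutionOn (ball z (2 * ρ)) (fun _ => f₁) u)
    (hv : IsSupersolutionOn (ball z (2 * ρ)) (fun _ => f₂) v)
    (huc : ContinuousOn u (closedBall z (2 * ρ))) (hvc : ContinuousOn v (closedBall z (2 * ρ))) :
    ∃ t, |t| < ρ ∧ ballMax u z ρ + ballMax (-v) z ρ
      < ballMax u z (ρ + t) + ballMax (-v) z (ρ - t) := by
  have hcb : ∀ {s}, s ≤ 2 * ρ → closedBall z s ⊆ closedBall z (2 * ρ) :=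
    closedBall_subset_closedBall
  have hob : ∀ {s}, s ≤ 2 * ρ → ball z s ⊆ ball z (2 * ρ) := ball_subset_ball
  have huρ := hu.mono_set (hob (show ρ ≤ 2 * ρ by linarith))
  have hucρ := huc.mono (hcb (show ρ ≤ 2 * ρ by linarith))
  set α := (ballMax u z ρ - u z) / ρ with hα
  have hα0 : 0 < α := div_pos (sub_pos.2 (huρ.lt_ballMax hρ hucρ hf₁)) hρ
  obtain ⟨t, ⟨ht, htρ⟩, hcurv⟩ := exists_forall_slope_exists_curvature hf hf₁ hα0 hρ
  have hchord : ballMax u z (ρ - t) ≤ ballMax u z ρ - α * t := by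
    have hαρ : α * ρ = ballMax u z ρ - u z := by rw [hα]; field_simp
    have := huρ.ballMax_le_chord hρ (s := ρ - t) (by linarith) (by linarith) hucρ
      fun _ _ => hf₁.le
    rw [← hα] at this
    linarith
  set a := (ballMax u z ρ - ballMax u z (ρ - t)) / t with ha
  have hat : a * t = ballMax u z ρ - ballMax u z (ρ - t) := by rw [ha]; field_simp
  have hαa : α ≤ a := by rw [ha, le_div_iff₀ ht]; linarith
  have ha0 : 0 < a := hα0.trans_le hαa
  obtain ⟨b, hb, hbF⟩ := hcurv a hαa
  have hrise := (hu.mono_set (hob (by linarith))).lt_ballMax_add ht htρ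
    (huc.mono (hcb (by linarith))) ha0 (by positivity) (fun _ _ σ hσ => (hbF σ hσ).2)
    (by linarith)
  by_contra! hle
  have hdrop := hle t (abs_lt.2 ⟨by linarith, htρ⟩)
  have hrise' := (hv.mono_set (hob (by linarith))).neg.lt_ballMax_add (a := a + b * t) (b := -b)
    ht htρ (hvc.neg.mono (hcb (by linarith))) (by positivity) (by nlinarith)
    (fun _ _ σ hσ => by
      have := (hbF (-σ) (by rwa [abs_neg])).1
      calc -b * (a + b * t + -b * (t / 2 + σ)) ^ 2 = -(b * (a + b * (t / 2 + -σ)) ^ 2) := by ring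
        _ < -f₂ := neg_lt_neg this)
    (by linarith)
  have hfall := hle (-t) (abs_lt.2 ⟨by linarith, by linarith⟩)
  rw [← sub_eq_add_neg, sub_neg_eq_add] at hfall
  linarith

lemma IsSubsolutionOn.exists_sub_lt_sub (hR : 0 < R) (hf : f₂ < f₁) (hf₁ : 0 < f₁)
    (hu : IsSubsolutionOn (ball z R) (fun _ => f₁) u)
    (hv : IsSupersolutionOn (ball z R) (fun _ => f₂) v)
    (huc : ContinuousOn u (closedBall z R)) (hvc : ContinuousOn v (closedBall z R))
    (hx₀ : x₀ ∈ closedBall z (R / 2)) (hy₀ : y₀ ∈ closedBall z (R / 2)) :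
    ∃ x ∈ closedBall z R, ∃ y ∈ closedBall z R, dist x y ≤ R ∧ u x₀ - v y₀ < u x - v y := by
  by_contra! hmax
  obtain ⟨ρ, rfl⟩ : ∃ ρ, R = 2 * ρ := ⟨R / 2, by ring⟩
  rw [mul_div_cancel_left₀ ρ two_ne_zero] at hx₀ hy₀
  obtain ⟨t, ht, hlt⟩ := hu.exists_ballMax_add_ballMax_neg_lt (by linarith) hf hf₁ hv huc hvc
  obtain ⟨ht₁, ht₂⟩ := abs_lt.1 ht
  have hle := ballMax_add_ballMax_neg_le (s := ρ + t) (t := ρ - t) (by linarith) (by linarith)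
    (by ring) huc hvc hmax
  have hsub : closedBall z ρ ⊆ closedBall z (2 * ρ) := closedBall_subset_closedBall (by linarith)
  have hu₀ := le_ballMax (huc.mono hsub) hx₀
  have hv₀ := le_ballMax (hvc.neg.mono hsub) hy₀
  rw [Pi.neg_apply] at hv₀
  linarith

/-- Convexity of `ballMax u z` and `ballMax (-v) z` in the radius makes every inequality between
the pairs below an equality. -/
lemma IsSubsolutionOn.eq_center_of_max_sub (hR : 0 < R)
    (hu : IsSubsolutionOn (ball z R) 0 u) (hv : IsSupersolutionOn (ball z R) 0 v)
    (huc : ContinuousOn u (closedBall z R)) (hvc : ContinuousOn v (closedBall z R))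
    (hx₀ : x₀ ∈ closedBall z (R / 2)) (hy₀ : y₀ ∈ closedBall z (R / 2))
    (hmax : ∀ x ∈ closedBall z R, ∀ y ∈ closedBall z R, dist x y ≤ R →
      u x - v y ≤ u x₀ - v y₀)
    (hmaxu : ∀ x ∈ closedBall z R, ∀ y ∈ closedBall z R, dist x y ≤ R →
      u x - v y = u x₀ - v y₀ → u x ≤ u x₀) : u z = u x₀ ∧ v z = v y₀ := by
  have hhalf : closedBall z (R / 2) ⊆ closedBall z R :=
    closedBall_subset_closedBall (by linarith)
  have hz : z ∈ closedBall z R := mem_closedBall_self hR.le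
  have hk : IsSubsolutionOn (ball z R) 0 (-v) := by simpa only [neg_zero] using hv.neg
  have hu₀ := le_ballMax (huc.mono hhalf) hx₀
  have hv₀ := le_ballMax (hvc.neg.mono hhalf) hy₀
  have huchord := hu.ballMax_le_chord hR (half_pos hR).le (half_le_self hR.le) huc fun _ _ => le_rfl
  have hvchord :=
    hk.ballMax_le_chord hR (half_pos hR).le (half_le_self hR.le) hvc.neg fun _ _ => le_rfl
  have hhalf' : ∀ d : ℝ, d / R * (R / 2) = d / 2 := fun d => by field_simp
  simp only [hhalf', Pi.neg_apply] at huchord hvchord hv₀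
  obtain ⟨x, hx, hxmax⟩ := exists_eq_ballMax hR.le huc
  obtain ⟨y, hy, hymax⟩ := exists_eq_ballMax hR.le hvc.neg
  have hxz := hmax x hx z hz hx
  have hzy := hmax z hz y hy (mem_closedBall'.1 hy)
  have hzx := le_ballMax huc hz
  rw [Pi.neg_apply] at hymax
  have hxle := hmaxu x hx z hz hx (by linarith)
  constructor <;> linarith

end BallMax

/-! ### Maximal pairs of nearby points -/

section MaxPair

variable {α ι : Type*} [PseudoMetricSpace α] {K Ω : Set α} {u v : α → ℝ} {𝒰 : ι → Set α}
  {κ c R : ℝ} {x : α}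

lemma exists_scale_of_le_sub (hK : IsCompact K) (hu : ContinuousOn u K) (hv : ContinuousOn v K)
    (h𝒰 : ∀ i, IsOpen (𝒰 i)) (hcover : ∀ x ∈ K, κ < u x - v x → x ∈ ⋃ i, 𝒰 i) (hc : κ < c) :
    ∃ R > 0, ∀ x ∈ K, ∀ y ∈ K, dist x y ≤ R → c ≤ u x - v y → ∃ i, ball x (2 * R) ⊆ 𝒰 i := by
  obtain ⟨c', hκc', hc'c⟩ := exists_between hc
  have hK' : IsCompact {x ∈ K | c' ≤ u x - v x} :=
    (hu.sub hv).upperSemicontinuousOn.isCompact_inter_preimage_Ici hK c'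
  obtain ⟨δ, hδ, hball⟩ := lebesgue_number_lemma_of_metric hK' h𝒰
    fun x hx => hcover x hx.1 (hκc'.trans_le hx.2)
  obtain ⟨η, hη, hvη⟩ := Metric.uniformContinuousOn_iff.1
    (hK.uniformContinuousOn_of_continuous hv) (c - c') (sub_pos.2 hc'c)
  refine ⟨min (δ / 2) (η / 2), by positivity, fun x hx y hy hxy hle => ?_⟩
  have hxyη : dist x y < η := hxy.trans_lt ((min_le_right _ _).trans_lt (half_lt_self hη))
  have hv' := abs_lt.1 (hvη x hx y hy hxyη)
  obtain ⟨i, hi⟩ := hball x ⟨hx, by linarith⟩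
  exact ⟨i, (ball_subset_ball (by linarith [min_le_left (δ / 2) (η / 2)])).trans hi⟩

lemma exists_max_pair (hK : IsCompact K) (hne : K.Nonempty) (hu : ContinuousOn u K)
    (hv : ContinuousOn v K) (hR : 0 ≤ R) :
    ∃ x₀ ∈ K, ∃ y₀ ∈ K, dist x₀ y₀ ≤ R ∧
      (∀ x ∈ K, ∀ y ∈ K, dist x y ≤ R → u x - v y ≤ u x₀ - v y₀) ∧
      ∀ x ∈ K, ∀ y ∈ K, dist x y ≤ R → u x - v y = u x₀ - v y₀ → u x ≤ u x₀ := by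
  set P : Set (α × α) := (K ×ˢ K) ∩ {p | dist p.1 p.2 ≤ R}
  have hP : IsCompact P :=
    (hK.prod hK).inter_right (isClosed_le (continuous_fst.dist continuous_snd) continuous_const)
  have hu' : ContinuousOn (fun p : α × α => u p.1) P :=
    hu.comp continuousOn_fst fun p hp => hp.1.1
  have hsub : ContinuousOn (fun p : α × α => u p.1 - v p.2) P :=
    hu'.sub (hv.comp continuousOn_snd fun p hp => hp.1.2)
  obtain ⟨x₁, hx₁⟩ := hne
  obtain ⟨p, hp, hmax⟩ :=
    hP.exists_isMaxOn ⟨(x₁, x₁), ⟨hx₁, hx₁⟩, (dist_self x₁).trans_le hR⟩ hsub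
  set Q : Set (α × α) := {q ∈ P | u p.1 - v p.2 ≤ u q.1 - v q.2}
  have hQ : IsCompact Q := hsub.upperSemicontinuousOn.isCompact_inter_preimage_Ici hP _
  obtain ⟨q, hq, hqmax⟩ := hQ.exists_isMaxOn ⟨p, hp, le_rfl⟩ (hu'.mono fun _ h => h.1)
  exact ⟨q.1, hq.1.1.1, q.2, hq.1.1.2, hq.1.2,
    fun x hx y hy hxy => (hmax (a := (x, y)) ⟨⟨hx, hy⟩, hxy⟩).trans hq.2,
    fun x hx y hy hxy heq => hqmax (a := (x, y)) ⟨⟨⟨hx, hy⟩, hxy⟩, hq.2.trans heq.ge⟩⟩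

lemma exists_interior_max_pair (hΩ : IsOpen Ω) (hK : IsCompact (closure Ω))
    (hu : ContinuousOn u (closure Ω)) (hv : ContinuousOn v (closure Ω))
    (h𝒰 : ∀ i, IsOpen (𝒰 i)) (hcover : Ω ⊆ ⋃ i, 𝒰 i)
    (hbd : ∀ ξ ∈ frontier Ω, u ξ - v ξ ≤ κ) (hx : x ∈ Ω) (hκ : κ < u x - v x) :
    ∃ R > 0, ∃ x₀ ∈ closure Ω, ∃ y₀ ∈ closure Ω, dist x₀ y₀ ≤ R ∧
      (∀ x ∈ closure Ω, ∀ y ∈ closure Ω, dist x y ≤ R → u x - v y ≤ u x₀ - v y₀) ∧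
      (∀ x ∈ closure Ω, ∀ y ∈ closure Ω, dist x y ≤ R → u x - v y = u x₀ - v y₀ → u x ≤ u x₀) ∧
      ∀ x ∈ closure Ω, ∀ y ∈ closure Ω, dist x y ≤ R → u x - v y = u x₀ - v y₀ →
        ∃ i, ball x (2 * R) ⊆ 𝒰 i := by
  have hcover' : ∀ x ∈ closure Ω, κ < u x - v x → x ∈ ⋃ i, 𝒰 i := fun x hx hlt => by
    by_contra hxi
    exact (hbd x (hΩ.frontier_eq ▸ ⟨hx, fun h => hxi (hcover h)⟩)).not_gt hlt
  obtain ⟨R, hR, hscale⟩ := exists_scale_of_le_sub hK hu hv h𝒰 hcover' hκ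
  obtain ⟨x₀, hx₀, y₀, hy₀, hxy, hmax, hmaxu⟩ :=
    exists_max_pair hK ⟨x, subset_closure hx⟩ hu hv hR.le
  have hle := hmax x (subset_closure hx) x (subset_closure hx) ((dist_self x).trans_le hR.le)
  exact ⟨R, hR, x₀, hx₀, y₀, hy₀, hxy, hmax, hmaxu,
    fun x hx y hy hxy heq => hscale x hx y hy hxy (hle.trans_eq heq.symm)⟩

lemma eq_empty_of_isClopen_of_isBounded {E : Type*} [NormedAddCommGroup E] [NormedSpace ℝ E]
    [Nontrivial E] {D : Set E} (hD : IsClopen D) (hb : Bornology.IsBounded D) : D = ∅ :=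
  (isClopen_iff.1 hD).resolve_right fun h =>
    NormedSpace.unbounded_univ ℝ E (h ▸ hb)

end MaxPair

/-! ### Comparison -/

section Comparison

variable {Ω : Set (EuclideanSpace ℝ (Fin n))}
  {F F₁ F₂ g h₁ h₂ u v : EuclideanSpace ℝ (Fin n) → ℝ} {R κ : ℝ}

lemma closedBall_midpoint_subset_ball {x₀ y₀ : 𝔼} (hR : 0 < R) (hxy : dist x₀ y₀ ≤ R) :
    closedBall (midpoint ℝ x₀ y₀) R ⊆ ball x₀ (2 * R) :=
  closedBall_subset_ball' (by
    rw [dist_midpoint_left, Real.norm_ofNat]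
    linarith)

lemma mem_closedBall_midpoint {x₀ y₀ : 𝔼} (hxy : dist x₀ y₀ ≤ R) :
    x₀ ∈ closedBall (midpoint ℝ x₀ y₀) (R / 2) ∧ y₀ ∈ closedBall (midpoint ℝ x₀ y₀) (R / 2) := by
  rw [mem_closedBall, mem_closedBall, dist_left_midpoint, dist_right_midpoint, Real.norm_ofNat]
  constructor <;> linarith

theorem IsSubsolutionOn.sub_le_of_lt (hΩ : IsOpen Ω) (hb : Bornology.IsBounded Ω)
    (hu : IsSubsolutionOn Ω F₁ u) (hv : IsSupersolutionOn Ω F₂ v)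
    (huc : ContinuousOn u (closure Ω)) (hvc : ContinuousOn v (closure Ω))
    (hF₁ : ContinuousOn F₁ Ω) (hF₂ : ContinuousOn F₂ Ω) (hlt : ∀ x ∈ Ω, F₂ x < F₁ x)
    (hpos : ∀ x ∈ Ω, 0 < F₁ x) (hbd : ∀ ξ ∈ frontier Ω, u ξ - v ξ ≤ κ) :
    ∀ x ∈ Ω, u x - v x ≤ κ := by
  by_contra! ⟨x₁, hx₁, hκ⟩
  let 𝒰 (p : {p : ℝ × ℝ // p.2 < p.1 ∧ 0 < p.1}) : Set 𝔼 :=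
    (Ω ∩ F₁ ⁻¹' Ioi p.1.1) ∩ (Ω ∩ F₂ ⁻¹' Iio p.1.2)
  have h𝒰 : ∀ p, IsOpen (𝒰 p) := fun p =>
    (hF₁.isOpen_inter_preimage hΩ isOpen_Ioi).inter (hF₂.isOpen_inter_preimage hΩ isOpen_Iio)
  have hcover : Ω ⊆ ⋃ p, 𝒰 p := fun x hx => by
    obtain ⟨f₁, hf₁, hf₁F⟩ := exists_between (max_lt (hlt x hx) (hpos x hx))
    obtain ⟨hFf₁, hf₁0⟩ := max_lt_iff.1 hf₁
    obtain ⟨f₂, hf₂F, hf₂⟩ := exists_between hFf₁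
    exact mem_iUnion.2 ⟨⟨(f₁, f₂), hf₂, hf₁0⟩, ⟨hx, hf₁F⟩, hx, hf₂F⟩
  obtain ⟨R, hR, x₀, hx₀, y₀, hy₀, hxy, hmax, -, hball⟩ :=
    exists_interior_max_pair hΩ hb.isCompact_closure huc hvc h𝒰 hcover hbd hx₁ hκ
  obtain ⟨⟨⟨f₁, f₂⟩, hf, hf₁⟩, hp⟩ := hball x₀ hx₀ y₀ hy₀ hxy rfl
  have hz := (closedBall_midpoint_subset_ball hR hxy).trans hp
  have hzΩ := hz.trans fun x hx => hx.1.1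
  have hz' := ball_subset_closedBall.trans hz
  obtain ⟨hxz, hyz⟩ := mem_closedBall_midpoint hxy
  obtain ⟨x, hx, y, hy, hxyR, hgt⟩ := IsSubsolutionOn.exists_sub_lt_sub hR hf hf₁
    (hu.mono (ball_subset_closedBall.trans hzΩ) fun x hx => (hz' hx).1.2.le)
    (hv.mono (ball_subset_closedBall.trans hzΩ) fun x hx => (hz' hx).2.2.le)
    (huc.mono (hzΩ.trans subset_closure)) (hvc.mono (hzΩ.trans subset_closure)) hxz hyz
  exact hgt.not_ge (hmax x (subset_closure (hzΩ hx)) y (subset_closure (hzΩ hy)) hxyR)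

lemma IsSubsolutionOn.sub_le_of_harmonic [NeZero n] (hΩ : IsOpen Ω) (hb : Bornology.IsBounded Ω)
    (hu : IsSubsolutionOn Ω 0 u) (hv : IsSupersolutionOn Ω 0 v)
    (huc : ContinuousOn u (closure Ω)) (hvc : ContinuousOn v (closure Ω))
    (hbd : ∀ ξ ∈ frontier Ω, u ξ - v ξ ≤ κ) : ∀ x ∈ Ω, u x - v x ≤ κ := by
  by_contra! ⟨x₁, hx₁, hκ⟩
  obtain ⟨R, hR, x₀, hx₀, y₀, hy₀, hxy, hmax, hmaxu, hball⟩ :=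
    exists_interior_max_pair hΩ hb.isCompact_closure huc hvc (fun _ : Unit => hΩ)
      (by rw [iUnion_const]) hbd hx₁ hκ
  set D : Set 𝔼 := (closure Ω ∩ u ⁻¹' {u x₀}) ∩ (closure Ω ∩ v ⁻¹' {v y₀})
  have hcenter : ∀ x ∈ closure Ω, ∀ y ∈ closure Ω, dist x y ≤ R → u x = u x₀ → v y = v y₀ →
      ∀ z, x ∈ closedBall z (R / 2) → y ∈ closedBall z (R / 2) → z ∈ D := by
    intro x hx y hy hxy hux hvy z hxz hyz
    obtain ⟨-, hΩx⟩ := hball x hx y hy hxy (by rw [hux, hvy])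
    have hzΩ : closedBall z R ⊆ Ω := (closedBall_subset_ball' (by
      rw [mem_closedBall'] at hxz; linarith)).trans hΩx
    have hzΩ' := hzΩ.trans subset_closure
    obtain ⟨huz, hvz⟩ := IsSubsolutionOn.eq_center_of_max_sub hR
      (hu.mono_set (ball_subset_closedBall.trans hzΩ))
      (hv.mono_set (ball_subset_closedBall.trans hzΩ)) (huc.mono hzΩ') (hvc.mono hzΩ') hxz hyz
      (fun a ha b hb => hux ▸ hvy ▸ hmax a (hzΩ' ha) b (hzΩ' hb))
      (fun a ha b hb => hux ▸ hvy ▸ hmaxu a (hzΩ' ha) b (hzΩ' hb))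
    have hz := hzΩ' (mem_closedBall_self hR.le)
    exact ⟨⟨hz, huz.trans hux⟩, hz, hvz.trans hvy⟩
  have hopen : IsOpen D := Metric.isOpen_iff.2 fun x hx => ⟨R / 2, half_pos hR, fun z hz => by
    have hxz : x ∈ closedBall z (R / 2) := mem_closedBall'.2 (le_of_lt hz)
    exact hcenter x hx.1.1 x hx.1.1 ((dist_self x).trans_le hR.le) hx.1.2 hx.2.2 z hxz hxz⟩
  have hclosed : IsClosed D :=
    (huc.preimage_isClosed_of_isClosed isClosed_closure isClosed_singleton).inter
      (hvc.preimage_isClosed_of_isClosed isClosed_closure isClosed_singleton)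
  have hempty : D = ∅ := eq_empty_of_isClopen_of_isBounded ⟨hclosed, hopen⟩
    (hb.closure.subset fun x hx => hx.1.1)
  obtain ⟨hxz, hyz⟩ := mem_closedBall_midpoint hxy
  exact hempty.subset (hcenter x₀ hx₀ y₀ hy₀ hxy rfl rfl _ hxz hyz)

/-- Since `(1 + ε) * u` is a subsolution for `(1 + ε) ^ 3 * F > F`, the strict comparison applies
to it, and `ε → 0`. -/
lemma IsSubsolutionOn.le_of_pos (hΩ : IsOpen Ω) (hb : Bornology.IsBounded Ω)
    (hF : ContinuousOn F Ω) (hpos : ∀ x ∈ Ω, 0 < F x)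
    (hu : IsSubsolutionOn Ω F u) (hv : IsSupersolutionOn Ω F v)
    (huc : ContinuousOn u (closure Ω)) (hvc : ContinuousOn v (closure Ω))
    (hbd : ∀ ξ ∈ frontier Ω, u ξ ≤ v ξ) : ∀ x ∈ Ω, u x ≤ v x := by
  intro x hx
  obtain ⟨M, hM⟩ := hb.isCompact_closure.exists_bound_of_continuousOn huc
  have hscaled : ∀ ε > 0, (1 + ε) * u x - v x ≤ ε * M := fun ε hε => by
    have hone : 1 < (1 + ε) ^ 3 := one_lt_pow₀ (by linarith) (by norm_num)
    refine (hu.const_mul (c := 1 + ε) (by linarith)).sub_le_of_lt hΩ hb hv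
      (continuousOn_const.mul huc) hvc (continuousOn_const.mul hF) hF
      (fun y hy => lt_mul_of_one_lt_left (hpos y hy) hone)
      (fun y hy => mul_pos (by linarith) (hpos y hy)) (fun ξ hξ => ?_) x hx
    have hMξ := (abs_le.1 (hM ξ (frontier_subset_closure hξ))).2
    linarith [hbd ξ hξ, mul_le_mul_of_nonneg_left hMξ hε.le]
  have hlim : Tendsto (fun ε : ℝ => ε * M - (1 + ε) * u x + v x) (𝓝[>] 0) (𝓝 (v x - u x)) := by
    have hcont : Continuous fun ε : ℝ => ε * M - (1 + ε) * u x + v x := by fun_prop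
    convert (hcont.tendsto 0).mono_left nhdsWithin_le_nhds using 2
    ring
  exact sub_nonneg.1 (ge_of_tendsto hlim (eventually_mem_nhdsWithin.mono fun ε hε => by
    linarith [hscaled ε hε]))

lemma frontier_subset_frontier_of_isOpen_sdiff {α : Type*} [TopologicalSpace α] {A Ω : Set α}
    (hA : IsOpen A) (hsub : A ⊆ Ω) (hdiff : IsOpen (Ω \ A)) : frontier A ⊆ frontier Ω := by
  have hΩ : IsOpen Ω := union_sdiff_cancel hsub ▸ hA.union hdiff
  rw [hA.frontier_eq, hΩ.frontier_eq]
  exact fun x hx => ⟨closure_mono hsub hx.1, fun hxΩ =>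
    (disjoint_sdiff_right.closure_left hdiff).le_bot ⟨hx.1, hxΩ, hx.2⟩⟩

/-- Each of `{F > 0}`, `{F < 0}` and `{F = 0}` is open and closed in `Ω`, so its frontier lies in
`frontier Ω`. -/
theorem IsSubsolutionOn.le_of_isOpen_zeros [NeZero n] (hΩ : IsOpen Ω)
    (hb : Bornology.IsBounded Ω) (hF : ContinuousOn F Ω) (hzero : IsOpen {x ∈ Ω | F x = 0})
    (hu : IsSubsolutionOn Ω F u) (hv : IsSupersolutionOn Ω F v)
    (huc : ContinuousOn u (closure Ω)) (hvc : ContinuousOn v (closure Ω))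
    (hbd : ∀ ξ ∈ frontier Ω, u ξ ≤ v ξ) : ∀ x ∈ Ω, u x ≤ v x := by
  have hpos : IsOpen {x ∈ Ω | 0 < F x} := hF.isOpen_inter_preimage hΩ isOpen_Ioi
  have hneg : IsOpen {x ∈ Ω | F x < 0} := hF.isOpen_inter_preimage hΩ isOpen_Iio
  have hpos_compl : Ω \ {x ∈ Ω | 0 < F x} = {x ∈ Ω | F x < 0} ∪ {x ∈ Ω | F x = 0} := by
    ext y
    simp only [Set.mem_sdiff, mem_union, mem_ofPred_eq]
    grind
  have hneg_compl : Ω \ {x ∈ Ω | F x < 0} = {x ∈ Ω | 0 < F x} ∪ {x ∈ Ω | F x = 0} := by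
    ext y
    simp only [Set.mem_sdiff, mem_union, mem_ofPred_eq]
    grind
  have hzero_compl : Ω \ {x ∈ Ω | F x = 0} = {x ∈ Ω | F x < 0} ∪ {x ∈ Ω | 0 < F x} := by
    ext y
    simp only [Set.mem_sdiff, mem_union, mem_ofPred_eq]
    grind
  have hbd_of : ∀ {A : Set 𝔼}, IsOpen A → A ⊆ Ω → IsOpen (Ω \ A) →
      ∀ ξ ∈ frontier A, u ξ ≤ v ξ := fun hA hsub hdiff ξ hξ =>
    hbd ξ (frontier_subset_frontier_of_isOpen_sdiff hA hsub hdiff hξ)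
  have huc' : ∀ {A}, A ⊆ Ω → ContinuousOn u (closure A) := fun h => huc.mono (closure_mono h)
  have hvc' : ∀ {A}, A ⊆ Ω → ContinuousOn v (closure A) := fun h => hvc.mono (closure_mono h)
  intro x hx
  rcases lt_trichotomy (F x) 0 with hlt | heq | hgt
  · have hsub : {x ∈ Ω | F x < 0} ⊆ Ω := sep_subset _ _
    have hle := (hv.mono_set hsub).neg.le_of_pos hneg (hb.subset hsub) (hF.mono hsub).neg
      (fun y hy => neg_pos.2 hy.2) (hu.mono_set hsub).neg (hvc' hsub).neg (huc' hsub).neg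
      (fun ξ hξ => neg_le_neg (hbd_of hneg hsub (hneg_compl ▸ hpos.union hzero) ξ hξ)) x ⟨hx, hlt⟩
    exact neg_le_neg_iff.1 hle
  · have hsub : {x ∈ Ω | F x = 0} ⊆ Ω := sep_subset _ _
    exact sub_nonpos.1 ((hu.mono hsub fun y hy => hy.2.ge).sub_le_of_harmonic hzero (hb.subset hsub)
      (hv.mono hsub fun y hy => hy.2.le) (huc' hsub) (hvc' hsub) (fun ξ hξ => sub_nonpos.2
        (hbd_of hzero hsub (hzero_compl ▸ hneg.union hpos) ξ hξ)) x ⟨hx, heq⟩)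
  · have hsub : {x ∈ Ω | 0 < F x} ⊆ Ω := sep_subset _ _
    exact (hu.mono_set hsub).le_of_pos hpos (hb.subset hsub) (hF.mono hsub) (fun y hy => hy.2)
      (hv.mono_set hsub) (huc' hsub) (hvc' hsub)
      (hbd_of hpos hsub (hpos_compl ▸ hneg.union hzero)) x ⟨hx, hgt⟩

theorem IsDirichletSolution.eqOn_of_isOpen_zeros [NeZero n] (hΩ : IsOpen Ω)
    (hb : Bornology.IsBounded Ω) (hF : ContinuousOn F Ω) (hzero : IsOpen {x ∈ Ω | F x = 0})
    (hh₁ : IsDirichletSolution Ω F g h₁) (hh₂ : IsDirichletSolution Ω F g h₂) : EqOn h₁ h₂ Ω := by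
  have hle : ∀ {h₁ h₂ : 𝔼 → ℝ}, IsDirichletSolution Ω F g h₁ → IsDirichletSolution Ω F g h₂ →
      ∀ x ∈ Ω, h₁ x ≤ h₂ x := fun hh₁ hh₂ =>
    hh₁.isSubsolutionOn.le_of_isOpen_zeros hΩ hb hF hzero hh₂.isSupersolutionOn
      hh₁.continuousOn hh₂.continuousOn fun ξ hξ =>
        ((hh₁.eqOn_frontier hξ).trans (hh₂.eqOn_frontier hξ).symm).le
  exact fun x hx => (hle hh₁ hh₂ x hx).antisymm (hle hh₂ hh₁ x hx)

end Comparison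

/-! ### Extended real-valued viscosity solutions -/

section Extended

variable {Ω : Set (EuclideanSpace ℝ (Fin n))} {F g h v w : EuclideanSpace ℝ (Fin n) → ℝ}
  {V W : EuclideanSpace ℝ (Fin n) → EReal}

lemma lowerSemicontinuousOn_coe_ereal_iff {α : Type*} [TopologicalSpace α] {s : Set α}
    {f : α → ℝ} :
    LowerSemicontinuousOn (fun x => (f x : EReal)) s ↔ LowerSemicontinuousOn f s :=
  ⟨fun h x hx y hy => (h x hx y (EReal.coe_lt_coe_iff.2 hy)).mono fun _ => EReal.coe_lt_coe_iff.1,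
    fun h => continuous_coe_real_ereal.comp_lowerSemicontinuousOn h EReal.coe_strictMono.monotone⟩

lemma lowerSemicontinuousOn_of_eqOn {α β : Type*} [TopologicalSpace α] [Preorder β] {s : Set α}
    {f₁ f₂ : α → β} (hf : LowerSemicontinuousOn f₁ s) (heq : EqOn f₁ f₂ s) :
    LowerSemicontinuousOn f₂ s :=
  fun x hx => LowerSemicontinuousWithinAt.congr_of_eventuallyEq (hf x hx) hx
    heq.eventuallyEq_nhdsWithin

lemma lowerSemicontinuousOn_closure_of_le_liminf {α γ : Type*} [TopologicalSpace α]
    [CompleteLinearOrder γ] [DenselyOrdered γ] {s : Set α} {f : α → γ} (hs : IsOpen s)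
    (hf : LowerSemicontinuousOn f s) (hfr : LowerSemicontinuousOn f (frontier s))
    (hlim : ∀ ξ ∈ frontier s, f ξ ≤ liminf f (𝓝[s] ξ)) : LowerSemicontinuousOn f (closure s) := by
  rw [closure_eq_self_union_frontier, lowerSemicontinuousOn_iff_le_liminf]
  rw [lowerSemicontinuousOn_iff_le_liminf] at hf hfr
  rintro x (hx | hx)
  · rw [nhdsWithin_eq_nhds.2 (mem_of_superset (hs.mem_nhds hx) subset_union_left),
      ← hs.nhdsWithin_eq hx]
    exact hf x hx
  · rw [nhdsWithin_union, liminf_sup_filter]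
    exact le_inf (hlim x hx) (hfr x hx)

lemma IsSupersolutionOn.isViscositySupersolution (hΩ : IsOpen Ω) (hv : IsSupersolutionOn Ω F v)
    (hlsc : LowerSemicontinuousOn v Ω) (hV : ∀ x ∈ Ω, V x = v x) :
    IsViscositySupersolution Ω F V where
  ne_bot x hx := hV x hx ▸ EReal.coe_ne_bot _
  lsc := lowerSemicontinuousOn_of_eqOn (lowerSemicontinuousOn_coe_ereal_iff.2 hlsc)
    fun x hx => (hV x hx).symm
  le_of_touches x₀ hx₀ φ hφ htouch := by
    have heq : v x₀ = φ x₀ := EReal.coe_eq_coe_iff.1 ((hV x₀ hx₀).symm.trans htouch.1)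
    refine hv x₀ hx₀ φ (hφ.contDiffAt (hΩ.mem_nhds hx₀)) heq.symm ?_
    filter_upwards [hΩ.mem_nhds hx₀] with x hx
    rcases eq_or_ne x x₀ with rfl | hne
    · exact heq.ge
    · exact (EReal.coe_lt_coe_iff.1 ((htouch.2 x hx hne).trans_eq (hV x hx))).le

/-- Subtracting `‖x - x₀‖ ^ 4` makes the contact strict, and interpolating with a constant below
`v` by a bump function makes the test function global. -/
lemma exists_contDiff_strict_test {φ : 𝔼 → ℝ} {x₀ : 𝔼} {M : ℝ} (hφ : ContDiffAt ℝ 2 φ x₀)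
    (hle : ∀ᶠ x in 𝓝 x₀, φ x ≤ v x) (hM : ∀ x ∈ Ω, M ≤ v x) :
    ∃ ψ : 𝔼 → ℝ, ContDiff ℝ 2 ψ ∧ ψ =ᶠ[𝓝 x₀] (fun x => φ x - ‖x - x₀‖ ^ 4) ∧
      ∀ x ∈ Ω, x ≠ x₀ → ψ x < v x := by
  obtain ⟨r, hr, hball⟩ := nhds_basis_closedBall.eventually_iff.1
    (hle.and (hφ.eventually (by simp)))
  let χ : ContDiffBump x₀ := ⟨r / 2, r, half_pos hr, half_lt_self hr⟩
  refine ⟨fun x => χ x * (φ x - ‖x - x₀‖ ^ 4 - (M - 1)) + (M - 1), ?_, ?_, fun x hx hne => ?_⟩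
  · refine contDiff_iff_contDiffAt.2 fun x => ContDiffAt.add ?_ contDiffAt_const
    by_cases hx : x ∈ tsupport χ
    · have hxr : x ∈ closedBall x₀ r := χ.tsupport_eq ▸ hx
      exact χ.contDiffAt.mul (((hball hxr).2.sub (contDiff_norm_sub_pow_four x₀).contDiffAt).sub
        contDiffAt_const)
    · refine contDiffAt_const (c := 0) |>.congr_of_eventuallyEq ?_
      filter_upwards [notMem_tsupport_iff_eventuallyEq.1 hx] with y hy
      rw [hy, Pi.zero_apply, zero_mul]
  · filter_upwards [χ.eventuallyEq_one] with x hx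
    rw [hx, Pi.one_apply, one_mul, sub_add_cancel]
  · have hMx := hM x hx
    rcases (χ.nonneg (x := x)).eq_or_lt' with hzero | hpos
    · simp only [hzero]
      linarith
    · have hxr : x ∈ closedBall x₀ r := ball_subset_closedBall (χ.support_eq ▸ hpos.ne')
      have hnorm : 0 < ‖x - x₀‖ ^ 4 := pow_pos (norm_pos_iff.2 (sub_ne_zero.2 hne)) 4
      have hq : φ x - ‖x - x₀‖ ^ 4 < v x := by linarith [(hball hxr).1]
      have hχ : χ x * (φ x - ‖x - x₀‖ ^ 4 - (M - 1)) < χ x * (v x - (M - 1)) := by gcongr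
      linarith [mul_le_of_le_one_left (by linarith : 0 ≤ v x - (M - 1)) (χ.le_one (x := x))]

lemma IsViscositySupersolution.isSupersolutionOn {M : ℝ} (hV : IsViscositySupersolution Ω F V)
    (hv : ∀ x ∈ Ω, V x = v x) (hM : ∀ x ∈ Ω, M ≤ v x) : IsSupersolutionOn Ω F v := by
  intro x₀ hx₀ φ hφ heq hle
  obtain ⟨ψ, hψ, hψφ, hlt⟩ := exists_contDiff_strict_test hφ hle hM
  have hψx₀ : ψ x₀ = v x₀ := by simpa [heq] using hψφ.eq_of_nhds
  have hF := hV.le_of_touches x₀ hx₀ ψ hψ.contDiffOn ⟨by rw [hv x₀ hx₀, hψx₀], fun x hx hne => by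
    rw [hv x hx]
    exact EReal.coe_lt_coe_iff.2 (hlt x hx hne)⟩
  rwa [infLaplacian_congr hψφ, infLaplacian_sub_norm_sub_pow_four hφ] at hF

lemma IsViscositySubsolution.neg (h : IsViscositySubsolution Ω F V) :
    IsViscositySupersolution Ω (-F) (-V) where
  ne_bot x hx := EReal.neg_eq_bot_iff.not.2 (h.ne_top x hx)
  lsc := continuous_neg.comp_upperSemicontinuousOn_antitone h.usc EReal.neg_strictAnti.antitone
  le_of_touches x₀ hx₀ φ hφ htouch := by
    have hneg := h.ge_of_touches x₀ hx₀ (fun y => -φ y) hφ.neg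
      ⟨by rw [EReal.coe_neg, ← htouch.1, Pi.neg_apply, neg_neg], fun x hx hne => by
        rw [EReal.coe_neg]
        exact EReal.lt_neg_comm.1 (htouch.2 x hx hne)⟩
    rw [infLaplacian_neg] at hneg
    exact le_neg_of_le_neg hneg

lemma IsViscositySupersolution.neg (h : IsViscositySupersolution Ω F V) :
    IsViscositySubsolution Ω (-F) (-V) where
  ne_top x hx := EReal.neg_eq_top_iff.not.2 (h.ne_bot x hx)
  usc := continuous_neg.comp_lowerSemicontinuousOn_antitone h.lsc EReal.neg_strictAnti.antitone
  ge_of_touches x₀ hx₀ φ hφ htouch := by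
    have hneg := h.le_of_touches x₀ hx₀ (fun y => -φ y) hφ.neg
      ⟨by rw [EReal.coe_neg, ← htouch.1, Pi.neg_apply, neg_neg], fun x hx hne => by
        rw [EReal.coe_neg]
        exact EReal.neg_lt_comm.1 (htouch.2 x hx hne)⟩
    rw [infLaplacian_neg] at hneg
    exact neg_le_of_neg_le hneg

lemma IsViscositySupersolution.inf (hV : IsViscositySupersolution Ω F V)
    (hW : IsViscositySupersolution Ω F W) :
    IsViscositySupersolution Ω F fun x => min (V x) (W x) where
  ne_bot x hx := by
    rcases min_choice (V x) (W x) with h | h <;> rw [h]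
    exacts [hV.ne_bot x hx, hW.ne_bot x hx]
  lsc := hV.lsc.inf hW.lsc
  le_of_touches x₀ hx₀ φ hφ htouch := by
    rcases min_choice (V x₀) (W x₀) with h | h
    · exact hV.le_of_touches x₀ hx₀ φ hφ ⟨h.symm.trans htouch.1, fun x hx hne =>
        (htouch.2 x hx hne).trans_le (min_le_left _ _)⟩
    · exact hW.le_of_touches x₀ hx₀ φ hφ ⟨h.symm.trans htouch.1, fun x hx hne =>
        (htouch.2 x hx hne).trans_le (min_le_right _ _)⟩

lemma IsViscositySolution.neg (h : IsViscositySolution Ω F V) :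
    IsViscositySolution Ω (-F) (-V) :=
  ⟨continuous_neg.comp_continuousOn h.continuousOn, h.subsolution.neg, h.supersolution.neg⟩

lemma HasBoundaryValues.neg (h : HasBoundaryValues Ω g V) : HasBoundaryValues Ω (-g) (-V) :=
  fun ξ hξ => (continuous_neg.tendsto _).comp (h ξ hξ)

lemma IsDirichletSolution.isViscositySolution (hΩ : IsOpen Ω) (hh : IsDirichletSolution Ω F g h)
    (hV : ∀ x ∈ Ω, V x = h x) : IsViscositySolution Ω F V where
  continuousOn := (continuous_coe_real_ereal.comp_continuousOn
    (hh.continuousOn.mono subset_closure)).congr hV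
  supersolution := hh.isSupersolutionOn.isViscositySupersolution hΩ
    (hh.continuousOn.mono subset_closure).lowerSemicontinuousOn hV
  subsolution := by
    have hneg := hh.isSubsolutionOn.neg.isViscositySupersolution hΩ (V := -V)
      (hh.continuousOn.mono subset_closure).neg.lowerSemicontinuousOn
      fun x hx => congrArg Neg.neg (hV x hx)
    simpa only [neg_neg] using hneg.neg

lemma IsDirichletSolution.hasBoundaryValues (hh : IsDirichletSolution Ω F g h)
    (hV : ∀ x ∈ Ω, V x = h x) : HasBoundaryValues Ω g V := by
  intro ξ hξ
  have hlim : Tendsto h (𝓝[Ω] ξ) (𝓝 (g ξ)) := hh.eqOn_frontier hξ ▸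
    (hh.continuousOn ξ (frontier_subset_closure hξ)).mono subset_closure
  exact ((continuous_coe_real_ereal.tendsto (g ξ)).comp hlim).congr'
    (eventually_mem_nhdsWithin.mono fun x hx => (hV x hx).symm)

/-! ### The Perron classes -/

lemma IsUpperFunction.coe_mem_upperClass (hΩ : IsOpen Ω) (hv : IsUpperFunction Ω F g v) :
    (fun x => (v x : EReal)) ∈ upperClass Ω F g :=
  ⟨hv.isSupersolutionOn.isViscositySupersolution hΩ (hv.lsc.mono subset_closure) fun _ _ => rfl,
    fun ξ hξ => (EReal.coe_le_coe_iff.2 (hv.le_on_frontier ξ hξ)).trans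
      (LowerSemicontinuousWithinAt.mono (lowerSemicontinuousOn_coe_ereal_iff.2 hv.lsc ξ
        (frontier_subset_closure hξ)) subset_closure).le_liminf⟩

lemma inf_mem_upperClass (hV : V ∈ upperClass Ω F g) (hW : W ∈ upperClass Ω F g) :
    (fun x => min (V x) (W x)) ∈ upperClass Ω F g :=
  ⟨hV.1.inf hW.1, fun ξ hξ => (le_min (hV.2 ξ hξ) (hW.2 ξ hξ)).trans_eq (liminf_min ..).symm⟩

lemma neg_mem_upperClass (hV : V ∈ lowerClass Ω F g) : -V ∈ upperClass Ω (-F) (-g) :=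
  ⟨hV.1.neg, fun ξ hξ => EReal.liminf_neg (v := V) ▸ EReal.neg_le_neg_iff.2 (hV.2 ξ hξ)⟩

lemma neg_mem_lowerClass (hV : V ∈ upperClass Ω F g) : -V ∈ lowerClass Ω (-F) (-g) :=
  ⟨hV.1.neg, fun ξ hξ => EReal.limsup_neg (v := V) ▸ EReal.neg_le_neg_iff.2 (hV.2 ξ hξ)⟩

lemma lowerPerron_eq_neg_upperPerron : lowerPerron Ω F g = -upperPerron Ω (-F) (-g) := by
  ext x
  refine le_antisymm (iSup₂_le fun V hV => EReal.le_neg_of_le_neg ?_) (EReal.neg_le_of_neg_le ?_)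
  · exact iInf₂_le (-V) (neg_mem_upperClass hV)
  · refine le_iInf₂ fun V hV => EReal.neg_le_of_neg_le ?_
    have hneg : -V ∈ lowerClass Ω F g := by simpa only [neg_neg] using neg_mem_lowerClass hV
    exact le_iSup₂ (f := fun (u : 𝔼 → EReal) (_ : u ∈ lowerClass Ω F g) => u x) (-V) hneg

lemma IsViscositySolution.mem_upperClass (hV : IsViscositySolution Ω F V)
    (hVg : HasBoundaryValues Ω g V) : V ∈ upperClass Ω F g :=
  ⟨hV.supersolution, fun ξ hξ => by
    have := mem_closure_iff_nhdsWithin_neBot.1 (frontier_subset_closure hξ)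
    exact (hVg ξ hξ).liminf_eq.ge⟩

lemma IsViscositySolution.mem_lowerClass (hV : IsViscositySolution Ω F V)
    (hVg : HasBoundaryValues Ω g V) : V ∈ lowerClass Ω F g := by
  simpa only [neg_neg] using neg_mem_lowerClass (hV.neg.mem_upperClass hVg.neg)

open Classical in
/-- The real-valued function that agrees with `V` in `Ω`, where `V` is meant to be finite, and
with `g` elsewhere. It turns boundary limits of `V` into semicontinuity on `closure Ω`. -/
noncomputable def boundaryExtension (Ω : Set 𝔼) (g : 𝔼 → ℝ) (V : 𝔼 → EReal) : 𝔼 → ℝ :=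
  Ω.piecewise (fun x => (V x).toReal) g

lemma boundaryExtension_of_mem {x : 𝔼} (hx : x ∈ Ω) :
    boundaryExtension Ω g V x = (V x).toReal := by
  classical exact piecewise_eq_of_mem _ _ _ hx

lemma boundaryExtension_of_notMem {x : 𝔼} (hx : x ∉ Ω) : boundaryExtension Ω g V x = g x := by
  classical exact piecewise_eq_of_notMem _ _ _ hx

lemma boundaryExtension_neg : boundaryExtension Ω (-g) (-V) = -boundaryExtension Ω g V := by
  ext x
  by_cases hx : x ∈ Ω
  · simp only [boundaryExtension_of_mem hx, Pi.neg_apply, EReal.toReal_neg_eq]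
  · simp only [boundaryExtension_of_notMem hx, Pi.neg_apply]

lemma isUpperFunction_boundaryExtension (hΩ : IsOpen Ω) (hb : Bornology.IsBounded Ω)
    (hg : ContinuousOn g (frontier Ω)) (hV : V ∈ upperClass Ω F g) (htop : ∀ x ∈ Ω, V x ≠ ⊤) :
    IsUpperFunction Ω F g (boundaryExtension Ω g V) := by
  have hVv : ∀ x ∈ Ω, V x = boundaryExtension Ω g V x := fun x hx => by
    rw [boundaryExtension_of_mem hx, EReal.coe_toReal (htop x hx) (hV.1.ne_bot x hx)]
  have hgv : EqOn (boundaryExtension Ω g V) g (frontier Ω) := fun ξ hξ =>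
    boundaryExtension_of_notMem (hΩ.frontier_eq ▸ hξ : ξ ∈ closure Ω \ Ω).2
  have hlsc : LowerSemicontinuousOn (boundaryExtension Ω g V) (closure Ω) := by
    refine lowerSemicontinuousOn_coe_ereal_iff.1 (lowerSemicontinuousOn_closure_of_le_liminf hΩ
      (lowerSemicontinuousOn_of_eqOn hV.1.lsc hVv)
      (lowerSemicontinuousOn_coe_ereal_iff.2 (hg.congr hgv).lowerSemicontinuousOn) fun ξ hξ => ?_)
    rw [hgv hξ, ← liminf_congr (eventually_mem_nhdsWithin.mono hVv)]
    exact hV.2 ξ hξ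
  obtain ⟨M, hM⟩ := hlsc.bddBelow_of_isCompact hb.isCompact_closure
  exact ⟨hlsc, hV.1.isSupersolutionOn hVv fun x hx =>
    hM (mem_image_of_mem _ (subset_closure hx)), fun ξ hξ => (hgv hξ).ge⟩

lemma isDirichletSolution_boundaryExtension (hΩ : IsOpen Ω) (hb : Bornology.IsBounded Ω)
    (hg : ContinuousOn g (frontier Ω)) (hu : V ∈ upperClass Ω F g) (hl : V ∈ lowerClass Ω F g) :
    IsDirichletSolution Ω F g (boundaryExtension Ω g V) := by
  have hupper := isUpperFunction_boundaryExtension hΩ hb hg hu hl.1.ne_top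
  have hlower := isUpperFunction_boundaryExtension hΩ hb hg.neg (neg_mem_upperClass hl)
    fun x hx => EReal.neg_eq_top_iff.not.2 (hu.1.ne_bot x hx)
  rw [boundaryExtension_neg] at hlower
  refine ⟨continuousOn_iff_lower_upperSemicontinuousOn.2 ⟨hupper.lsc, ?_⟩,
    hupper.isSupersolutionOn, ?_, ?_⟩
  · simpa only [neg_neg] using upperSemicontinuousOn_neg hlower.lsc
  · simpa only [neg_neg] using hlower.isSupersolutionOn.neg
  · exact fun ξ hξ => (neg_le_neg_iff.1 (hlower.le_on_frontier ξ hξ)).antisymm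
      (hupper.le_on_frontier ξ hξ)

end Extended

section PerronSolutions

variable {Ω : Set (EuclideanSpace ℝ (Fin n))} {F g : EuclideanSpace ℝ (Fin n) → ℝ}
  {V V₁ V₂ : EuclideanSpace ℝ (Fin n) → EReal} {C S : ℝ}

/-- Truncating `V` by a bounded upper function makes it real-valued without leaving the class. -/
lemma coe_perronInf_le_of_mem_upperClass [NeZero n] (hΩ : IsOpen Ω) (hb : Bornology.IsBounded Ω)
    (hF : ∀ x ∈ Ω, |F x| ≤ C) (hgc : ContinuousOn g (frontier Ω))
    (hg : ∀ x ∈ frontier Ω, |g x| ≤ S) (hV : V ∈ upperClass Ω F g) :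
    ∀ x ∈ Ω, (perronInf Ω F g x : EReal) ≤ V x := by
  intro x hx
  obtain ⟨w, hw, -⟩ := exists_isUpperFunction_forall_le hb
    (fun x hx => (abs_le.1 (hF x hx)).1) fun x hx => (abs_le.1 (hg x hx)).2
  have hW := inf_mem_upperClass hV (hw.coe_mem_upperClass hΩ)
  have hWtop : ∀ x, min (V x) (w x : EReal) ≠ ⊤ := fun x =>
    ne_top_of_le_ne_top (EReal.coe_ne_top _) (min_le_right _ _)
  have hle := perronInf_le hΩ hb (fun x hx => (abs_le.1 (hF x hx)).2)
    (fun x hx => (abs_le.1 (hg x hx)).1)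
    (isUpperFunction_boundaryExtension hΩ hb hgc hW fun x _ => hWtop x) (subset_closure hx)
  rw [boundaryExtension_of_mem hx] at hle
  calc (perronInf Ω F g x : EReal) ≤ ((min (V x) (w x)).toReal : EReal) :=
        EReal.coe_le_coe_iff.2 hle
    _ = min (V x) (w x) := EReal.coe_toReal (hWtop x) (hW.1.ne_bot x hx)
    _ ≤ V x := min_le_left _ _

lemma upperPerron_eq_perronInf [NeZero n] (hΩ : IsOpen Ω) (hb : Bornology.IsBounded Ω)
    (hFc : ContinuousOn F Ω) (hF : ∀ x ∈ Ω, |F x| ≤ C) (hgc : ContinuousOn g (frontier Ω))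
    (hg : ∀ x ∈ frontier Ω, |g x| ≤ S) :
    ∀ x ∈ Ω, upperPerron Ω F g x = perronInf Ω F g x := fun x hx =>
  le_antisymm (iInf₂_le (fun x => (perronInf Ω F g x : EReal))
    ((isDirichletSolution_perronInf hΩ hb hFc hF hgc hg).isUpperFunction.coe_mem_upperClass hΩ))
    (le_iInf₂ fun _ hV => coe_perronInf_le_of_mem_upperClass hΩ hb hF hgc hg hV x hx)

theorem isViscositySolution_and_hasBoundaryValues_upperPerron [NeZero n]
    (hΩ : IsOpen Ω) (hb : Bornology.IsBounded Ω) (hFc : ContinuousOn F Ω)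
    (hF : ∀ x ∈ Ω, |F x| ≤ C) (hgc : ContinuousOn g (frontier Ω)) :
    IsViscositySolution Ω F (upperPerron Ω F g) ∧ HasBoundaryValues Ω g (upperPerron Ω F g) := by
  obtain ⟨S, hg⟩ := (hb.isCompact_closure.of_isClosed_subset isClosed_frontier
    frontier_subset_closure).exists_bound_of_continuousOn hgc
  have hsol := isDirichletSolution_perronInf hΩ hb hFc hF hgc hg
  have heq := upperPerron_eq_perronInf hΩ hb hFc hF hgc hg
  exact ⟨hsol.isViscositySolution hΩ heq, hsol.hasBoundaryValues heq⟩

theorem isViscositySolution_and_hasBoundaryValues_lowerPerron [NeZero n]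
    (hΩ : IsOpen Ω) (hb : Bornology.IsBounded Ω) (hFc : ContinuousOn F Ω)
    (hF : ∀ x ∈ Ω, |F x| ≤ C) (hgc : ContinuousOn g (frontier Ω)) :
    IsViscositySolution Ω F (lowerPerron Ω F g) ∧ HasBoundaryValues Ω g (lowerPerron Ω F g) := by
  obtain ⟨hsol, hbv⟩ := isViscositySolution_and_hasBoundaryValues_upperPerron hΩ hb
    hFc.neg (fun x hx => (abs_neg (F x)).trans_le (hF x hx)) hgc.neg
  rw [lowerPerron_eq_neg_upperPerron]
  exact ⟨by simpa only [neg_neg] using hsol.neg, by simpa only [neg_neg] using hbv.neg⟩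

theorem IsViscositySolution.eqOn_of_isOpen_zeros [NeZero n] (hΩ : IsOpen Ω)
    (hb : Bornology.IsBounded Ω) (hFc : ContinuousOn F Ω) (hzero : IsOpen {x ∈ Ω | F x = 0})
    (hgc : ContinuousOn g (frontier Ω))
    (hV₁ : IsViscositySolution Ω F V₁) (hbv₁ : HasBoundaryValues Ω g V₁)
    (hV₂ : IsViscositySolution Ω F V₂) (hbv₂ : HasBoundaryValues Ω g V₂) : EqOn V₁ V₂ Ω := by
  intro x hx
  have hsol : ∀ {V}, IsViscositySolution Ω F V → HasBoundaryValues Ω g V →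
      IsDirichletSolution Ω F g (boundaryExtension Ω g V) := fun hV hbv =>
    isDirichletSolution_boundaryExtension hΩ hb hgc (hV.mem_upperClass hbv)
      (hV.mem_lowerClass hbv)
  have heq := (hsol hV₁ hbv₁).eqOn_of_isOpen_zeros hΩ hb hFc hzero (hsol hV₂ hbv₂) hx
  rw [boundaryExtension_of_mem hx, boundaryExtension_of_mem hx] at heq
  exact (EReal.toReal_eq_toReal (hV₁.subsolution.ne_top x hx) (hV₁.supersolution.ne_bot x hx)
    (hV₂.subsolution.ne_top x hx) (hV₂.supersolution.ne_bot x hx)).1 heq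

lemma isOpen_zeros_of_le_abs_or_eq_zero {α : Type*} [TopologicalSpace α] {s : Set α} {f : α → ℝ}
    (hs : IsOpen s) (hf : (∃ c : ℝ, 0 < c ∧ ∀ x ∈ s, c ≤ |f x|) ∨ ∀ x ∈ s, f x = 0) :
    IsOpen {x ∈ s | f x = 0} := by
  rcases hf with ⟨c, hc, hle⟩ | hzero
  · convert isOpen_empty
    exact eq_empty_of_forall_notMem fun x hx =>
      abs_pos.1 (hc.trans_le (hle x hx.1)) hx.2
  · rwa [sep_eq_self_iff_mem_true.2 hzero]

end PerronSolutions

end InfPoisson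

theorem mainTheorem12_general (n : ℕ) (hn : 1 ≤ n) (Ω : Set (EuclideanSpace ℝ (Fin n)))
    (hΩ_open : IsOpen Ω) (hΩ_bdd : Bornology.IsBounded Ω)
    (F : EuclideanSpace ℝ (Fin n) → ℝ) (hF_cont : ContinuousOn F Ω)
    (hF_bdd : ∃ C : ℝ, ∀ x ∈ Ω, |F x| ≤ C)
    (g : EuclideanSpace ℝ (Fin n) → ℝ) (hg_cont : ContinuousOn g (frontier Ω)) :
    (InfPoisson.IsViscositySolution Ω F (InfPoisson.upperPerron Ω F g) ∧
      InfPoisson.HasBoundaryValues Ω g (InfPoisson.upperPerron Ω F g)) ∧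
    (InfPoisson.IsViscositySolution Ω F (InfPoisson.lowerPerron Ω F g) ∧
      InfPoisson.HasBoundaryValues Ω g (InfPoisson.lowerPerron Ω F g)) ∧
    (∀ h : EuclideanSpace ℝ (Fin n) → EReal,
      InfPoisson.IsViscositySolution Ω F h → InfPoisson.HasBoundaryValues Ω g h →
        ∀ x ∈ Ω, InfPoisson.upperPerron Ω F g x ≤ h x ∧ h x ≤ InfPoisson.lowerPerron Ω F g x) ∧
    (IsOpen {x ∈ Ω | F x = 0} →
      (∀ x ∈ Ω, InfPoisson.upperPerron Ω F g x = InfPoisson.lowerPerron Ω F g x) ∧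
      (∀ h₁ h₂ : EuclideanSpace ℝ (Fin n) → EReal,
        InfPoisson.IsViscositySolution Ω F h₁ → InfPoisson.HasBoundaryValues Ω g h₁ →
        InfPoisson.IsViscositySolution Ω F h₂ → InfPoisson.HasBoundaryValues Ω g h₂ →
          ∀ x ∈ Ω, h₁ x = h₂ x)) := by
  have : NeZero n := ⟨Nat.one_le_iff_ne_zero.1 hn⟩
  obtain ⟨C, hF_le⟩ := hF_bdd
  have hupper := InfPoisson.isViscositySolution_and_hasBoundaryValues_upperPerron hΩ_open hΩ_bdd
    hF_cont hF_le hg_cont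
  have hlower := InfPoisson.isViscositySolution_and_hasBoundaryValues_lowerPerron hΩ_open hΩ_bdd
    hF_cont hF_le hg_cont
  refine ⟨hupper, hlower, fun h hsol hbv x _ => ⟨iInf₂_le h (hsol.mem_upperClass hbv),
    le_iSup₂ (f := fun u _ => u x) h (hsol.mem_lowerClass hbv)⟩, fun hzero => ?_⟩
  have hunique := fun {h₁ h₂} hsol₁ hbv₁ hsol₂ hbv₂ =>
    InfPoisson.IsViscositySolution.eqOn_of_isOpen_zeros (V₁ := h₁) (V₂ := h₂) hΩ_open hΩ_bdd
      hF_cont hzero hg_cont hsol₁ hbv₁ hsol₂ hbv₂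
  exact ⟨hunique hupper.1 hupper.2 hlower.1 hlower.2,
    fun _ _ hsol₁ hbv₁ hsol₂ hbv₂ => hunique hsol₁ hbv₁ hsol₂ hbv₂⟩

theorem mainTheorem12 (n : ℕ) (hn : 1 ≤ n) (Ω : Set (EuclideanSpace ℝ (Fin n)))
    (hΩ_open : IsOpen Ω) (hΩ_conn : IsConnected Ω) (hΩ_bdd : Bornology.IsBounded Ω)
    (F : EuclideanSpace ℝ (Fin n) → ℝ) (hF_cont : ContinuousOn F Ω)
    (hF_bdd : ∃ C : ℝ, ∀ x ∈ Ω, |F x| ≤ C)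
    (g : EuclideanSpace ℝ (Fin n) → ℝ) (hg_cont : ContinuousOn g (frontier Ω)) :
    (InfPoisson.IsViscositySolution Ω F (InfPoisson.upperPerron Ω F g) ∧
      InfPoisson.HasBoundaryValues Ω g (InfPoisson.upperPerron Ω F g)) ∧
    (InfPoisson.IsViscositySolution Ω F (InfPoisson.lowerPerron Ω F g) ∧
      InfPoisson.HasBoundaryValues Ω g (InfPoisson.lowerPerron Ω F g)) ∧
    (∀ h : EuclideanSpace ℝ (Fin n) → EReal,
      InfPoisson.IsViscositySolution Ω F h → InfPoisson.HasBoundaryValues Ω g h →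
        ∀ x ∈ Ω, InfPoisson.upperPerron Ω F g x ≤ h x ∧ h x ≤ InfPoisson.lowerPerron Ω F g x) ∧
    (((∃ c : ℝ, 0 < c ∧ ∀ x ∈ Ω, c ≤ |F x|) ∨ (∀ x ∈ Ω, F x = 0)) →
      (∀ x ∈ Ω, InfPoisson.upperPerron Ω F g x = InfPoisson.lowerPerron Ω F g x) ∧
      (∀ h₁ h₂ : EuclideanSpace ℝ (Fin n) → EReal,
        InfPoisson.IsViscositySolution Ω F h₁ → InfPoisson.HasBoundaryValues Ω g h₁ →
        InfPoisson.IsViscositySolution Ω F h₂ → InfPoisson.HasBoundaryValues Ω g h₂ →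
          ∀ x ∈ Ω, h₁ x = h₂ x)) := by
  obtain ⟨hupper, hlower, hbetween, hunique⟩ :=
    mainTheorem12_general n hn Ω hΩ_open hΩ_bdd F hF_cont hF_bdd g hg_cont
  exact ⟨hupper, hlower, hbetween, fun hF =>
    hunique (InfPoisson.isOpen_zeros_of_le_abs_or_eq_zero hΩ_open hF)⟩
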